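/- Let $S$ be a Pauli stabilizer group on $n$ qubits (an abelian subgroup of the $n$-qubit Pauli group with phases $\{\pm1,\pm i\}$, not containing $-1$), let $\mathcal C=\{|\psi\rangle : s|\psi\rangle=|\psi\rangle\ \forall s\in S\}$ be its code subspace, and let $A|A^c$ be a bipartition of the qubits. For a unit vector $|\psi\rangle\in\mathcal C$ put $\rho_A=\operatorname{Tr}_{A^c}|\psi\rangle\langle\psi|$. Let $V:\mathcal H_L\to(\mathbb C^2)^{\otimes n}$ be an encoding isometry with image $\mathcal C$, and let $\mathcal M_A\subseteq\mathcal L(\mathcal H_L)$ be the logical Pauli subalgebra supported on $A$, i.e. the algebra generated by all $V^\dagger PV$ with $P$ a Pauli string that commutes with $S$ and acts trivially on $A^c$. A block decomposition for $\mathcal M_A$ is an orthogonal decomposition $\mathcal H_L=\bigoplus_\alpha \mathcal H_{a_\alpha}\otimes\mathcal H_{a_\alpha^c}$ (all factors nonzero) with $\mathcal M_A=\bigoplus_\alpha\mathcal L(\mathcal H_{a_\alpha})\otimes I_{a_\alpha^c}$. With $\Pi_\alpha$ the projection onto the $\alpha$-th block, the block-diagonal logical state is $$\rho_a=\bigoplus_\alpha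 p_\alpha\rho_{a_\alpha},\qquad p_\alpha\rho_{a_\alpha}=\operatorname{Tr}_{a_\alpha^c}\big(\Pi_\alpha V^\dagger|\psi\rangle\langle\psi|V\Pi_\alpha\big).$$ For $t\in[0,\infty]$ let $S_t$ be the Rényi entropy with natural logarithm: $S_t(\rho)=\frac1{1-t}\log\operatorname{Tr}\rho^t$ for $t\ne1,\infty$ (trace over the support of $\rho$), $S_1=S$ is the von Neumann entropy, and $S_\infty(\rho)=-\log\lambda_{\max}(\rho)$. Then block decompositions for $\mathcal M_A$ exist, $\mathcal C$ contains stabilizer states (unit vectors fixed by $2^n$ elements of the Pauli group), and there is an integer $d_\chi\ge1$, depending only on $S$ and $A$, such that with $\mathscr A=\log d_\chi$, for every encoding isometry $V$ and every block decomposition for $\mathcal M_A$: 1. There are density matrices $\chi_\alpha$ on spaces $\mathcal H_{\chi_\alpha}$ and an isometry $U:\bigoplus_\alpha\mathcal H_{a_\alpha}\otimes\mathcal H_{\chi_\alpha}\to\mathcal H_A$ with $\rho_A=U\big(\bigoplus_\alpha p_\alpha\rho_{a_\alpha}\otimes\chi_\alpha\big)U^\dagger$ for every unit vector $|\psi\rangle\in\mathcal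 C$, and $S_t(\chi_\alpha)=\mathscr A$ for all $\alpha$ and all $t\in[0,\infty]$. 2. For every unit vector $|\psi\rangle\in\mathcal C$ and every $t\in[0,\infty]$, $S_t(\rho_A)=S_t(\rho_a)+\mathscr A$. 3. For every unit vector $|\psi\rangle\in\mathcal C$, counted with multiplicity and up to additional zero eigenvalues, $$\mathrm{Spec}(\rho_A)=\bigcup_{\lambda\in\mathrm{Spec}(\rho_a)}\Big\{\underbrace{\tfrac{\lambda}{d_\chi},\dots,\tfrac{\lambda}{d_\chi}}_{d_\chi\text{ times}}\Big\}.$$ 4. For every unit vector $|\psi\rangle\in\mathcal C$ and every stabilizer state $|\phi\rangle\in\mathcal C$, with reduced state $\phi_A$ and logical state $\phi_a$ defined as above, $$S(\rho_A)=S(\rho_a)+\big(S(\phi_A)-S(\phi_a)\big).$$ -/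

import Mathlib

open Matrix
open scoped Kronecker ENNReal ComplexOrder

noncomputable section

/-! ### Qubits, Pauli operators, stabilizer codes -/

/-- Operators on the Hilbert space of `n` qubits, as matrices in the computational basis
(basis vectors are bit strings `Fin n → Fin 2`). -/
abbrev QubitOp (n : ℕ) : Type := Matrix (Fin n → Fin 2) (Fin n → Fin 2) ℂ

/-- Labels of the four single-qubit Pauli matrices. -/
inductive PauliLabel : Type
  | I
  | X
  | Y
  | Z

/-- The single-qubit Pauli matrices. -/
def PauliLabel.mat : PauliLabel → Matrix (Fin 2) (Fin 2) ℂ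
  | .I => 1
  | .X => !![0, 1; 1, 0]
  | .Y => !![0, -Complex.I; Complex.I, 0]
  | .Z => !![1, 0; 0, -1]

/-- The Pauli string `p 0 ⊗ p 1 ⊗ ⋯ ⊗ p (n-1)`. -/
def pauliString {n : ℕ} (p : Fin n → PauliLabel) : QubitOp n :=
  Matrix.of fun x y => ∏ i, (p i).mat (x i) (y i)

theorem PauliLabel.exists_mat_mul (p q : PauliLabel) :
    ∃ (k : ℕ) (r : PauliLabel), p.mat * q.mat = Complex.I ^ k • r.mat := by
  cases p <;> cases q
  · exact ⟨0, .I, by simp [PauliLabel.mat]⟩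
  · exact ⟨0, .X, by simp [PauliLabel.mat]⟩
  · exact ⟨0, .Y, by simp [PauliLabel.mat]⟩
  · exact ⟨0, .Z, by simp [PauliLabel.mat]⟩
  · exact ⟨0, .X, by simp [PauliLabel.mat]⟩
  · exact ⟨0, .I, by ext i j; fin_cases i <;> fin_cases j <;> simp [PauliLabel.mat]⟩
  · exact ⟨1, .Z, by ext i j; fin_cases i <;> fin_cases j <;> simp [PauliLabel.mat]⟩
  · exact ⟨3, .Y, by ext i j; fin_cases i <;> fin_cases j <;> simp [PauliLabel.mat, pow_succ]⟩
  · exact ⟨0, .Y, by simp [PauliLabel.mat]⟩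
  · exact ⟨3, .Z, by ext i j; fin_cases i <;> fin_cases j <;> simp [PauliLabel.mat, pow_succ]⟩
  · exact ⟨0, .I, by ext i j; fin_cases i <;> fin_cases j <;> simp [PauliLabel.mat]⟩
  · exact ⟨1, .X, by ext i j; fin_cases i <;> fin_cases j <;> simp [PauliLabel.mat]⟩
  · exact ⟨0, .Z, by simp [PauliLabel.mat]⟩
  · exact ⟨1, .Y, by ext i j; fin_cases i <;> fin_cases j <;> simp [PauliLabel.mat]⟩
  · exact ⟨3, .X, by ext i j; fin_cases i <;> fin_cases j <;> simp [PauliLabel.mat, pow_succ]⟩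
  · exact ⟨0, .I, by ext i j; fin_cases i <;> fin_cases j <;> simp [PauliLabel.mat]⟩

theorem PauliLabel.mat_mul_self (p : PauliLabel) : p.mat * p.mat = 1 := by
  cases p <;> ext i j <;> fin_cases i <;> fin_cases j <;> simp [PauliLabel.mat]

theorem pauliString_mul_apply {n : ℕ} (p q : Fin n → PauliLabel) (x y : Fin n → Fin 2) :
    (pauliString p * pauliString q) x y = ∏ i, ((p i).mat * (q i).mat) (x i) (y i) := by
  simp only [Matrix.mul_apply, pauliString, Matrix.of_apply, ← Finset.prod_mul_distrib]
  rw [Finset.prod_univ_sum, Fintype.piFinset_univ]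

theorem pauliString_exists_mul {n : ℕ} (p q : Fin n → PauliLabel) :
    ∃ (k : ℕ) (r : Fin n → PauliLabel),
      pauliString p * pauliString q = Complex.I ^ k • pauliString r := by
  choose k r h using fun i => PauliLabel.exists_mat_mul (p i) (q i)
  refine ⟨∑ i, k i, r, ?_⟩
  ext x y
  rw [pauliString_mul_apply]
  simp [h, pauliString, Finset.prod_mul_distrib, Finset.prod_pow_eq_pow_sum]

theorem pauliString_one {n : ℕ} : pauliString (fun _ : Fin n => PauliLabel.I) = 1 := by
  ext x y
  simp only [pauliString, PauliLabel.mat, Matrix.of_apply, Matrix.one_apply]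
  by_cases h : x = y
  · simp [h]
  · obtain ⟨i, hi⟩ := Function.ne_iff.mp h
    rw [if_neg h]
    exact Finset.prod_eq_zero (Finset.mem_univ i) (if_neg hi)

theorem pauliString_mul_self {n : ℕ} (p : Fin n → PauliLabel) :
    pauliString p * pauliString p = 1 := by
  rw [← pauliString_one]
  ext x y
  rw [pauliString_mul_apply]
  simp only [PauliLabel.mat_mul_self, pauliString, Matrix.of_apply]
  rfl

/-- The `n`-qubit Pauli group: all Pauli strings with a phase in `{1, i, -1, -i}`. -/
def pauliGroup (n : ℕ) : Subgroup (QubitOp n)ˣ where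
  carrier := {u | ∃ (k : ℕ) (p : Fin n → PauliLabel),
    (u : QubitOp n) = Complex.I ^ k • pauliString p}
  mul_mem' := by
    rintro u v ⟨k, p, hu⟩ ⟨l, q, hv⟩
    obtain ⟨m, r, h⟩ := pauliString_exists_mul p q
    refine ⟨k + l + m, r, ?_⟩
    rw [Units.val_mul, hu, hv, Matrix.smul_mul, Matrix.mul_smul, h, smul_smul, smul_smul,
      pow_add, pow_add, mul_assoc]
  one_mem' := ⟨0, fun _ => .I, by simp [pauliString_one]⟩
  inv_mem' := by
    rintro u ⟨k, p, hu⟩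
    refine ⟨3 * k, p, ?_⟩
    apply Units.inv_eq_of_mul_eq_one_right
    rw [hu, Matrix.smul_mul, Matrix.mul_smul, pauliString_mul_self, smul_smul, ← pow_add,
      show k + 3 * k = 4 * k by ring, pow_mul, Complex.I_pow_four, one_pow, one_smul]

/-- A Pauli stabilizer group: an abelian subgroup of the Pauli group without `-1`. -/
structure IsStabilizerGroup {n : ℕ} (S : Subgroup (QubitOp n)ˣ) : Prop where
  le_pauliGroup : S ≤ pauliGroup n
  comm : ∀ s ∈ S, ∀ t ∈ S, s * t = t * s
  neg_one_notMem : (-1 : (QubitOp n)ˣ) ∉ S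

/-- The code subspace: all vectors fixed by every stabilizer. -/
def codeSpace {n : ℕ} (S : Subgroup (QubitOp n)ˣ) : Submodule ℂ ((Fin n → Fin 2) → ℂ) where
  carrier := {ψ | ∀ s ∈ S, (s : QubitOp n) *ᵥ ψ = ψ}
  add_mem' := by
    intro ψ φ hψ hφ s hs
    rw [Matrix.mulVec_add, hψ s hs, hφ s hs]
  zero_mem' := fun s _ => Matrix.mulVec_zero _
  smul_mem' := by
    intro c ψ hψ s hs
    rw [Matrix.mulVec_smul, hψ s hs]

/-- Unit vectors. -/
def IsUnitVector {m : Type*} [Fintype m] (ψ : m → ℂ) : Prop := star ψ ⬝ᵥ ψ = 1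

/-- A (pure) stabilizer state: a unit vector fixed by `2 ^ n` elements of the Pauli group. -/
def IsStabilizerState {n : ℕ} (φ : (Fin n → Fin 2) → ℂ) : Prop :=
  IsUnitVector φ ∧
    Nat.card {u : (QubitOp n)ˣ // u ∈ pauliGroup n ∧ (u : QubitOp n) *ᵥ φ = φ} = 2 ^ n

/-- `V : H_L → H_phys` is an encoding isometry of the code: an isometry whose image is the
code subspace. The logical space is `κ → ℂ`. -/
structure IsEncoding {n : ℕ} {κ : Type*} [Fintype κ] [DecidableEq κ]
    (S : Subgroup (QubitOp n)ˣ) (V : Matrix (Fin n → Fin 2) κ ℂ) : Prop where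
  isometry : Vᴴ * V = 1
  range_eq : LinearMap.range V.mulVecLin = codeSpace S

/-- The logical Pauli subalgebra supported on `A`: the algebra, acting on the logical space,
generated by all `V† P V`, where `P` is a Pauli string that commutes with the stabilizer group
and acts as the identity outside `A`. -/
def logicalPauliAlgebra {n : ℕ} {κ : Type*} [Fintype κ] [DecidableEq κ]
    (S : Subgroup (QubitOp n)ˣ) (A : Finset (Fin n)) (V : Matrix (Fin n → Fin 2) κ ℂ) :
    Subalgebra ℂ (Matrix κ κ ℂ) :=
  Algebra.adjoin ℂ {M | ∃ p : Fin n → PauliLabel, (∀ i, i ∉ A → p i = PauliLabel.I) ∧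
    (∀ s ∈ S, Commute (s : QubitOp n) (pauliString p)) ∧ M = Vᴴ * pauliString p * V}

/-! ### Reduced states -/

/-- Glue a bit string on `A` and a bit string on the complement of `A`. -/
def glueBits {n : ℕ} (A : Finset (Fin n)) (x : {i // i ∈ A} → Fin 2)
    (z : {i // i ∉ A} → Fin 2) : Fin n → Fin 2 :=
  fun i => if h : i ∈ A then x ⟨i, h⟩ else z ⟨i, h⟩

/-- The reduced density matrix `ρ_A = Tr_{A^c} |ψ⟩⟨ψ|`. -/
def reducedState {n : ℕ} (A : Finset (Fin n)) (ψ : (Fin n → Fin 2) → ℂ) :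
    Matrix ({i // i ∈ A} → Fin 2) ({i // i ∈ A} → Fin 2) ℂ :=
  Matrix.of fun x y => ∑ z : {i // i ∉ A} → Fin 2,
    ψ (glueBits A x z) * star (ψ (glueBits A y z))

/-! ### Block decompositions and the logical (bulk) state -/

/-- A block decomposition `H_L = ⨁_α H_{a_α} ⊗ H_{a_α^c}` for an algebra `M` on `H_L`: an
orthonormal basis `|α, i⟩|α, j⟩` of `H_L` (the columns of the unitary `W`) in which
`M = ⨁_α L(H_{a_α}) ⊗ 1`. -/
structure BlockDecomposition {κ : Type*} [Fintype κ] [DecidableEq κ]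
    (M : Subalgebra ℂ (Matrix κ κ ℂ)) where
  numBlocks : ℕ
  dimA : Fin numBlocks → ℕ
  dimAc : Fin numBlocks → ℕ
  dimA_pos : ∀ α, 0 < dimA α
  dimAc_pos : ∀ α, 0 < dimAc α
  W : Matrix κ (Σ α : Fin numBlocks, Fin (dimA α) × Fin (dimAc α)) ℂ
  isometry : Wᴴ * W = 1
  unitary : W * Wᴴ = 1
  mem_iff : ∀ X : Matrix κ κ ℂ, X ∈ M ↔
    ∃ O : ∀ α, Matrix (Fin (dimA α)) (Fin (dimA α)) ℂ,
      Wᴴ * X * W = Matrix.blockDiagonal'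
        fun α => O α ⊗ₖ (1 : Matrix (Fin (dimAc α)) (Fin (dimAc α)) ℂ)

namespace BlockDecomposition

variable {n : ℕ} {κ : Type*} [Fintype κ] [DecidableEq κ] {M : Subalgebra ℂ (Matrix κ κ ℂ)}

/-- The block `p_α ρ_{a_α} = Tr_{a_α^c} (Π_α V† |ψ⟩⟨ψ| V Π_α)`. -/
def bulkBlock (B : BlockDecomposition M) (V : Matrix (Fin n → Fin 2) κ ℂ)
    (ψ : (Fin n → Fin 2) → ℂ) (α : Fin B.numBlocks) :
    Matrix (Fin (B.dimA α)) (Fin (B.dimA α)) ℂ :=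
  Matrix.of fun i i' => ∑ j : Fin (B.dimAc α),
    (B.Wᴴ * (Vᴴ * Matrix.vecMulVec ψ (star ψ) * V) * B.W) ⟨α, (i, j)⟩ ⟨α, (i', j)⟩

/-- The block-diagonal logical state `ρ_a = ⨁_α p_α ρ_{a_α}`. -/
def bulkState (B : BlockDecomposition M) (V : Matrix (Fin n → Fin 2) κ ℂ)
    (ψ : (Fin n → Fin 2) → ℂ) :
    Matrix (Σ α, Fin (B.dimA α)) (Σ α, Fin (B.dimA α)) ℂ :=
  Matrix.blockDiagonal' (B.bulkBlock V ψ)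

end BlockDecomposition

/-! ### Spectra and entropies -/

/-- The eigenvalues with multiplicity. -/
def eigenvalueMultiset {m : Type*} [Fintype m] [DecidableEq m] (ρ : Matrix m m ℂ) :
    Multiset ℂ :=
  ρ.charpoly.roots

/-- The Rényi entropy of order `t ∈ [0, ∞]` of a density matrix (natural logarithm):
`(1 - t)⁻¹ log Tr ρ ^ t` for `t ≠ 1, ∞` (the trace runs over the support of `ρ`, so that order
`0` gives the logarithm of the rank), the von Neumann entropy `- Tr ρ log ρ` for `t = 1`, and
minus the logarithm of the largest eigenvalue for `t = ∞`. -/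
def renyiEntropy {m : Type*} [Fintype m] [DecidableEq m] (t : ℝ≥0∞) (ρ : Matrix m m ℂ) : ℝ :=
  if t = 1 then ((eigenvalueMultiset ρ).map fun z => Real.negMulLog z.re).sum
  else if t = ∞ then - Real.log (sSup {x : ℝ | (x : ℂ) ∈ eigenvalueMultiset ρ})
  else (1 - t.toReal)⁻¹ *
    Real.log (((eigenvalueMultiset ρ).filter (· ≠ 0)).map fun z => z.re ^ t.toReal).sum

/-- The von Neumann entropy. -/
def vonNeumannEntropy {m : Type*} [Fintype m] [DecidableEq m] (ρ : Matrix m m ℂ) : ℝ :=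
  renyiEntropy 1 ρ

end

/-!
The proof compares the logical algebra `M` of Pauli operators supported on `A` with the operators
on the qubits of `A`, through the map `Φ X = Tr_{A^c} (V X V†)` (`reduceMap`).

* `Φ` only sees `M`: a Pauli string on `A` that fails to commute with some stabilizer has vanishing
  matrix elements in the code, so `Φ X` is determined by the expectation values of `X` against `M`
  (`reduceMap_eq_of_trace_eq`). Hence `ρ_A = Φ (⨁ p_α ρ_{a_α} ⊗ 1 / dim a_α^c)`.
* On `M`, `Φ` is a `*`-homomorphism up to a scalar: it intertwines left and right multiplication by
  logical Paulis with multiplication by their restrictions to `A`, and `Φ 1`, being proportional to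
  the sum of the stabilizers supported on `A`, satisfies `Φ 1 * Φ 1 = λ Φ 1` (`reduceMap_mul`).
* After division by `λ` all minimal projections of `M` are mapped to projections of the same rank
  `d` (`trace_reduceMap_of_minimal`). The eigenspaces of a maximal commutative group `K` of Pauli
  operators that are supported on `A` and commute with the code's stabilizers give minimal
  projections, both in `M` and on the qubits of `A`. Since Pauli operators are scalar or traceless,
  the nonzero ones on `A` all have equal trace, which is `d`; it depends on neither the encoding nor
  the blocks.

Therefore `λ⁻¹ Φ` carries the matrix units of any block decomposition to partial isometries between
mutually orthogonal projections of rank `d`, and these assemble into the isometry `U` with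
`ρ_A = U (⨁ p_α ρ_{a_α} ⊗ 1 / d) U†` (`exists_isometry_reducedState`). The states `χ_α` are
maximally mixed of dimension `d`, each eigenvalue of `ρ_a` splits into `d` equal parts, and all Rényi
entropies increase by `log d`.

The same eigenspaces of `K`, now on the logical space, yield a block decomposition: conjugation by
Pauli operators permutes them, the blocks are the orbits, and the operators moving one member of an
orbit to another are the matrix units (`nonempty_blockDecomposition_of_span`). A stabilizer state of
the code is a unit vector whose stabilizer in the Pauli group is as large as possible
(`exists_isStabilizerState_mem`).
-/


/-! ### Projections, partial isometries and spectra -/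

section LinearAlgebra

variable {m k : Type*} [Fintype m] [DecidableEq m] [Fintype k] [DecidableEq k]

theorem exists_unitary_diagonalization {p : Matrix m m ℂ} (hH : pᴴ = p) :
    ∃ (Q : Matrix m m ℂ) (f : m → ℝ), Qᴴ * Q = 1 ∧ p = Q * diagonal (fun i => (f i : ℂ)) * Qᴴ := by
  have hH' : p.IsHermitian := hH
  refine ⟨(hH'.eigenvectorUnitary : Matrix m m ℂ), hH'.eigenvalues,
    Unitary.coe_star_mul_self hH'.eigenvectorUnitary, ?_⟩
  conv_lhs => rw [hH'.spectral_theorem, Unitary.conjStarAlgAut_apply]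
  rfl

/-- A Hermitian idempotent factors through an orthonormal basis of its range. -/
theorem exists_orthonormal_factor_of_projection {p : Matrix m m ℂ} (hH : pᴴ = p)
    (hp : p * p = p) :
    ∃ (r : ℕ) (F : Matrix m (Fin r) ℂ), Fᴴ * F = 1 ∧ F * Fᴴ = p ∧ p.trace = r := by
  obtain ⟨Q, f, hQQ, hs⟩ := exists_unitary_diagonalization hH
  have hDD : ∀ i, f i * f i = f i := by
    have h1 : diagonal (fun i => (f i : ℂ)) = Qᴴ * p * Q := by
      rw [hs]
      simp only [← Matrix.mul_assoc, hQQ, Matrix.one_mul]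
      rw [Matrix.mul_assoc, hQQ, Matrix.mul_one]
    have h2 : diagonal (fun i => (f i : ℂ)) * diagonal (fun i => (f i : ℂ)) =
        diagonal (fun i => (f i : ℂ)) := by
      calc _ = Qᴴ * p * (Q * Qᴴ) * p * Q := by rw [h1]; simp only [Matrix.mul_assoc]
        _ = Qᴴ * (p * p) * Q := by
          rw [mul_eq_one_comm.mp hQQ]; simp only [Matrix.mul_assoc, Matrix.one_mul]
        _ = _ := by rw [hp, ← h1]
    intro i
    have := congrFun (congrFun h2 i) i
    simp only [diagonal_mul_diagonal, diagonal_apply_eq] at this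
    exact_mod_cast this
  have h01 : ∀ i, f i ≠ 1 → f i = 0 := fun i hi => by
    by_contra h
    exact hi (mul_right_cancel₀ h ((hDD i).trans (one_mul _).symm))
  let e := Fintype.equivFin {i // f i = 1}
  let F : Matrix m (Fin (Fintype.card {i // f i = 1})) ℂ := Q.submatrix id fun j => (e.symm j : m)
  have hF1 : Fᴴ * F = 1 := by
    ext a b
    have := congrFun (congrFun hQQ (e.symm a)) (e.symm b)
    simp only [Matrix.mul_apply, conjTranspose_apply, Matrix.one_apply] at this
    simp only [Matrix.mul_apply, conjTranspose_apply, F, submatrix_apply, id, this]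
    rw [Matrix.one_apply]
    by_cases h : a = b
    · simp [h]
    · have h' : (e.symm a : m) ≠ e.symm b := fun h' => h (e.symm.injective (Subtype.ext h'))
      rw [if_neg h, if_neg h']
  have hF2 : F * Fᴴ = p := by
    ext a b
    have h1 : (F * Fᴴ) a b = ∑ i : {i // f i = 1}, Q a i * star (Q b i) :=
      Equiv.sum_comp e.symm (fun j : {i // f i = 1} => Q a j * star (Q b j))
    have h2 : ∑ i : {i // f i = 1}, Q a i * star (Q b i) =
        ∑ i ∈ Finset.univ.filter (fun i => f i = 1), Q a i * star (Q b i) :=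
      (Finset.sum_subtype (Finset.univ.filter fun i => f i = 1) (fun x => by simp)
        fun i => Q a i * star (Q b i)).symm
    rw [h1, h2, Finset.sum_filter, hs, Matrix.mul_apply]
    refine Finset.sum_congr rfl fun i _ => ?_
    rw [mul_diagonal, conjTranspose_apply]
    split_ifs with h
    · simp [h]
    · simp [h01 i h]
  refine ⟨_, F, hF1, hF2, ?_⟩
  have : p.trace = (F * Fᴴ).trace := by rw [hF2]
  rw [this, trace_mul_comm, hF1]
  simp

/-- Partial isometries `y α i`, with common initial projection `q α` inside each block `α` and
mutually orthogonal ranges, assemble into one isometry `U`; in the basis given by its columns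
the operators `y α i * (y α i')ᴴ` become matrix units tensored with the identity. -/
theorem exists_isometry_of_partialIsometries {N : ℕ} {a r : Fin N → ℕ}
    (q : Fin N → Matrix m m ℂ) (hqH : ∀ α, (q α)ᴴ = q α) (hq : ∀ α, q α * q α = q α)
    (hr : ∀ α, (q α).trace = r α) (y : ∀ α, Fin (a α) → Matrix m m ℂ)
    (hy : ∀ α i, (y α i)ᴴ * y α i = q α)
    (hy' : ∀ α i i', i ≠ i' → (y α i)ᴴ * y α i' = 0)
    (hy'' : ∀ α β i i', α ≠ β → (y α i)ᴴ * y β i' = 0) :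
    ∃ U : Matrix m (Σ α, Fin (a α) × Fin (r α)) ℂ, Uᴴ * U = 1 ∧
      (∀ O : ∀ α, Matrix (Fin (a α)) (Fin (a α)) ℂ,
        U * blockDiagonal' (fun α => O α ⊗ₖ (1 : Matrix (Fin (r α)) (Fin (r α)) ℂ)) * Uᴴ =
          ∑ α, ∑ i, ∑ i', O α i i' • (y α i * q α * (y α i')ᴴ)) ∧
      ∀ (X : Matrix m m ℂ) (O : ∀ α, Matrix (Fin (a α)) (Fin (a α)) ℂ),
        (∀ α i i', q α * ((y α i)ᴴ * X * y α i') * q α = O α i i' • q α) →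
        (∀ α β i i', α ≠ β → q α * ((y α i)ᴴ * X * y β i') * q β = 0) →
        Uᴴ * X * U =
          blockDiagonal' fun α => O α ⊗ₖ (1 : Matrix (Fin (r α)) (Fin (r α)) ℂ) := by
  have hF : ∀ α, ∃ F : Matrix m (Fin (r α)) ℂ, Fᴴ * F = 1 ∧ F * Fᴴ = q α := by
    intro α
    obtain ⟨s, F, h1, h2, h3⟩ := exists_orthonormal_factor_of_projection (hqH α) (hq α)
    obtain rfl : s = r α := by
      have := h3.symm.trans (hr α)
      exact_mod_cast this
    exact ⟨F, h1, h2⟩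
  choose F hF1 hF2 using hF
  have hqF : ∀ α, q α * F α = F α := fun α => by
    rw [← hF2, Matrix.mul_assoc, hF1, Matrix.mul_one]
  have hFq : ∀ α, (F α)ᴴ * q α = (F α)ᴴ := fun α => by
    rw [← hF2, ← Matrix.mul_assoc, hF1, Matrix.one_mul]
  -- the columns of `U` are the images under `y α i` of an orthonormal basis of the range of `q α`
  let U : Matrix m (Σ α, Fin (a α) × Fin (r α)) ℂ :=
    Matrix.of fun x s => (y s.1 s.2.1 * F s.1) x s.2.2
  have hentry : ∀ (X : Matrix m m ℂ) (s t : Σ α, Fin (a α) × Fin (r α)), (Uᴴ * X * U) s t =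
      ((F s.1)ᴴ * (q s.1 * ((y s.1 s.2.1)ᴴ * X * y t.1 t.2.1) * q t.1) * F t.1) s.2.2 t.2.2 := by
    intro X s t
    have h1 : (F s.1)ᴴ * (q s.1 * ((y s.1 s.2.1)ᴴ * X * y t.1 t.2.1) * q t.1) * F t.1 =
        (y s.1 s.2.1 * F s.1)ᴴ * X * (y t.1 t.2.1 * F t.1) := by
      calc _ = ((F s.1)ᴴ * q s.1) * ((y s.1 s.2.1)ᴴ * X * y t.1 t.2.1) * (q t.1 * F t.1) := by
            simp only [Matrix.mul_assoc]
        _ = _ := by rw [hFq, hqF, conjTranspose_mul]; simp only [Matrix.mul_assoc]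
    rw [h1]
    simp only [Matrix.mul_apply, conjTranspose_apply, U, Matrix.of_apply]
  have hX : ∀ (X : Matrix m m ℂ) (O : ∀ α, Matrix (Fin (a α)) (Fin (a α)) ℂ),
        (∀ α i i', q α * ((y α i)ᴴ * X * y α i') * q α = O α i i' • q α) →
        (∀ α β i i', α ≠ β → q α * ((y α i)ᴴ * X * y β i') * q β = 0) →
        Uᴴ * X * U =
          blockDiagonal' fun α => O α ⊗ₖ (1 : Matrix (Fin (r α)) (Fin (r α)) ℂ) := by
    intro X O h1 h2
    ext ⟨α, i, j⟩ ⟨β, i', j'⟩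
    rw [hentry]
    by_cases h : α = β
    · subst h
      simp only [h1, blockDiagonal'_apply_eq, kronecker_apply]
      rw [Matrix.mul_smul, Matrix.smul_mul, hFq, hF1]
      simp
    · simp only [h2 _ _ _ _ h]
      rw [blockDiagonal'_apply_ne _ _ _ h]
      simp
  refine ⟨U, ?_, ?_, hX⟩
  · have := hX 1 (fun α => 1) (fun α i i' => ?_) (fun α β i i' h => ?_)
    · rw [Matrix.mul_one] at this
      rw [this, ← blockDiagonal'_one]
      congr 1
      funext α
      exact one_kronecker_one
    · rw [Matrix.mul_one]
      by_cases h : i = i'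
      · subst h; simp [hy, hq]
      · simp [hy' _ _ _ h, h]
    · simp [hy'' _ _ _ _ h]
  · intro O
    have h1 : ∀ α i i', y α i * q α * (y α i')ᴴ = (y α i * F α) * (y α i' * F α)ᴴ := by
      intro α i i'
      rw [← hF2, conjTranspose_mul]; simp only [Matrix.mul_assoc]
    ext x x'
    have h2 : ∀ s : Σ α, Fin (a α) × Fin (r α),
        (U * blockDiagonal' (fun α => O α ⊗ₖ (1 : Matrix (Fin (r α)) (Fin (r α)) ℂ))) x s =
          ∑ i, (y s.1 i * F s.1) x s.2.2 * O s.1 i s.2.1 := by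
      rintro ⟨α, i', j⟩
      rw [Matrix.mul_apply, Fintype.sum_sigma, Finset.sum_eq_single α]
      · simp only [Fintype.sum_prod_type, blockDiagonal'_apply_eq, kronecker_apply,
          Matrix.one_apply, U, Matrix.of_apply]
        simp
      · intro β _ hβ
        refine Finset.sum_eq_zero fun t _ => ?_
        rw [blockDiagonal'_apply_ne _ _ _ hβ, mul_zero]
      · simp
    rw [Matrix.mul_apply]
    simp only [h1, Matrix.sum_apply, Matrix.smul_apply, h2, Fintype.sum_sigma,
      Fintype.sum_prod_type, Finset.sum_mul]
    refine Finset.sum_congr rfl fun α _ => ?_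
    have h3 : ∀ i i', O α i i' • (y α i * F α * (y α i' * F α)ᴴ) x x' =
        ∑ j, (y α i * F α) x j * O α i i' * Uᴴ ⟨α, i', j⟩ x' := by
      intro i i'
      rw [Matrix.mul_apply, Finset.smul_sum]
      refine Finset.sum_congr rfl fun j _ => ?_
      simp only [conjTranspose_apply, U, Matrix.of_apply, smul_eq_mul]
      ring
    simp only [h3]
    calc _ = ∑ i', ∑ i, ∑ j, (y α i * F α) x j * O α i i' * Uᴴ ⟨α, i', j⟩ x' :=
          Finset.sum_congr rfl fun i' _ => Finset.sum_comm
      _ = _ := Finset.sum_comm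

/-- Two minimal projections of a matrix algebra that are not orthogonal have the same trace. -/
theorem trace_eq_of_minimal {e p : Matrix m m ℂ} (he : eᴴ = e) (hp : pᴴ = p) (hee : e * e = e)
    (hpp : p * p = p) {c c' : ℂ} (h1 : e * p * e = c • e) (h2 : p * e * p = c' • p)
    (h0 : p * e ≠ 0) : e.trace = p.trace := by
  have hne : e * p * e ≠ 0 := by
    intro h
    apply h0
    rw [← conjTranspose_mul_self_eq_zero, conjTranspose_mul, he, hp,
      show e * p * (p * e) = e * (p * p) * e by simp only [Matrix.mul_assoc], hpp, h]
  have hc : c ≠ 0 := by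
    rintro rfl
    simp [h1] at hne
  have hcc : c * c = c' * c := by
    have h3 : e * (p * e * p) * e = (c * c) • e := by
      calc e * (p * e * p) * e = (e * p * e) * (p * e) := by simp only [Matrix.mul_assoc]
        _ = c • (e * p * e) := by
          conv_lhs => rw [h1, Matrix.smul_mul, ← Matrix.mul_assoc]
        _ = _ := by rw [h1, smul_smul]
    rw [h2, Matrix.mul_smul, Matrix.smul_mul, h1, smul_smul] at h3
    have he0 : e ≠ 0 := by
      rintro rfl
      simp at h0
    exact (smul_left_injective ℂ he0 h3).symm
  have hc' : c = c' := mul_right_cancel₀ hc hcc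
  have t1 : (e * p * e).trace = (p * e).trace := by
    rw [Matrix.mul_assoc, trace_mul_comm, Matrix.mul_assoc, hee]
  have t2 : (p * e * p).trace = (p * e).trace := by
    rw [trace_mul_comm, ← Matrix.mul_assoc, hpp]
  rw [h1, trace_smul] at t1
  rw [h2, trace_smul, ← hc'] at t2
  exact smul_right_injective ℂ hc (t1.trans t2.symm)

/-- The spectrum of `Y * D * Yᴴ` with `D` diagonal and `Y` an isometry. -/
theorem eigenvalueMultiset_isometry_diagonal {Y : Matrix m k ℂ} (hY : Yᴴ * Y = 1) (f : k → ℂ) :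
    eigenvalueMultiset (Y * diagonal f * Yᴴ) =
      Finset.univ.val.map f + Multiset.replicate (Fintype.card m - Fintype.card k) 0 := by
  have hcard : Fintype.card k ≤ Fintype.card m := by
    have h1 : (1 : Matrix k k ℂ).rank ≤ Fintype.card m := by
      rw [← hY]
      exact (rank_mul_le_right _ _).trans (rank_le_card_height _)
    rwa [rank_one] at h1
  rw [eigenvalueMultiset, Matrix.mul_assoc, charpoly_mul_comm_of_le _ _ hcard, Matrix.mul_assoc,
    hY, Matrix.mul_one, charpoly_diagonal, Polynomial.roots_mul, add_comm]
  · congr 1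
    · exact Polynomial.roots_multiset_prod_X_sub_C (Finset.univ.val.map f) ▸ by simp
    · simp [Multiset.nsmul_singleton]
  · refine mul_ne_zero (pow_ne_zero _ Polynomial.X_ne_zero) ?_
    exact Finset.prod_ne_zero_iff.mpr fun i _ => Polynomial.X_sub_C_ne_zero _

/-- The spectrum of `⨁ X α ⊗ 1 / d`, embedded by an isometry: every eigenvalue of the
density matrix `⨁ X α` is split into `d` equal parts. -/
theorem exists_spectrum_of_isometry_blockDiagonal {N d : ℕ} {a : Fin N → ℕ}
    {X : ∀ α, Matrix (Fin (a α)) (Fin (a α)) ℂ} (hX : (blockDiagonal' X).PosSemidef)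
    (hX1 : (blockDiagonal' X).trace = 1) {U : Matrix m (Σ α, Fin (a α) × Fin d) ℂ}
    (hU : Uᴴ * U = 1) :
    ∃ f : (Σ α, Fin (a α)) → ℝ, (∀ i, 0 ≤ f i) ∧ ∑ i, f i = 1 ∧
      eigenvalueMultiset (blockDiagonal' X) = Finset.univ.val.map (fun i => (f i : ℂ)) ∧
      ∃ z : ℕ, eigenvalueMultiset (U * blockDiagonal'
          (fun α => X α ⊗ₖ ((d : ℂ)⁻¹ • (1 : Matrix (Fin d) (Fin d) ℂ))) * Uᴴ) =
        (eigenvalueMultiset (blockDiagonal' X)).bind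
          (fun μ => Multiset.replicate d (μ / (d : ℂ))) + Multiset.replicate z 0 := by
  obtain ⟨Q, f, hQ, hs⟩ := exists_unitary_diagonalization hX.isHermitian
  have hσ : eigenvalueMultiset (blockDiagonal' X) = Finset.univ.val.map (fun i => (f i : ℂ)) := by
    rw [hs, eigenvalueMultiset_isometry_diagonal hQ]
    simp
  have hD : diagonal (fun i => (f i : ℂ)) = Qᴴ * blockDiagonal' X * Q := by
    rw [hs]
    simp only [← Matrix.mul_assoc, hQ, Matrix.one_mul]
    rw [Matrix.mul_assoc, hQ, Matrix.mul_one]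
  refine ⟨f, fun i => ?_, ?_, hσ, ?_⟩
  · have h1 := (hX.conjTranspose_mul_mul_same Q).diag_nonneg (i := i)
    rw [← hD, diagonal_apply_eq] at h1
    exact_mod_cast h1
  · have h1 : (diagonal (fun i => (f i : ℂ))).trace = 1 := by
      rw [hD, trace_mul_comm, ← Matrix.mul_assoc, mul_eq_one_comm.mp hQ, Matrix.one_mul, hX1]
    rw [trace_diagonal] at h1
    exact_mod_cast h1
  · let e : (Σ α, Fin (a α)) × Fin d ≃ Σ α, Fin (a α) × Fin d :=
      ⟨fun s => ⟨s.1.1, s.1.2, s.2⟩, fun s => (⟨s.1, s.2.1⟩, s.2.2), fun _ => rfl, fun _ => rfl⟩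
    let U' := U.submatrix id e
    have hU' : U'ᴴ * U' = 1 := by
      ext s t
      change (Uᴴ * U) (e s) (e t) = _
      rw [hU, Matrix.one_apply, Matrix.one_apply]
      simp only [e.apply_eq_iff_eq]
    have hsub : (blockDiagonal' (fun α => X α ⊗ₖ
        ((d : ℂ)⁻¹ • (1 : Matrix (Fin d) (Fin d) ℂ)))).submatrix e e =
        blockDiagonal' X ⊗ₖ ((d : ℂ)⁻¹ • (1 : Matrix (Fin d) (Fin d) ℂ)) := by
      ext ⟨⟨α, i⟩, j⟩ ⟨⟨β, i'⟩, j'⟩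
      by_cases h : α = β
      · subst h
        simp only [submatrix_apply, e, Equiv.coe_fn_mk, kronecker_apply, blockDiagonal'_apply_eq]
      · simp only [submatrix_apply, e, Equiv.coe_fn_mk, kronecker_apply,
          blockDiagonal'_apply_ne _ _ _ h, zero_mul]
    have hρ : U * blockDiagonal'
          (fun α => X α ⊗ₖ ((d : ℂ)⁻¹ • (1 : Matrix (Fin d) (Fin d) ℂ))) * Uᴴ =
        (U' * (Q ⊗ₖ (1 : Matrix (Fin d) (Fin d) ℂ))) *
          diagonal (fun s : (Σ α, Fin (a α)) × Fin d => (f s.1 : ℂ) * (d : ℂ)⁻¹) *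
          (U' * (Q ⊗ₖ (1 : Matrix (Fin d) (Fin d) ℂ)))ᴴ := by
      have h1 : diagonal (fun s : (Σ α, Fin (a α)) × Fin d => (f s.1 : ℂ) * (d : ℂ)⁻¹) =
          diagonal (fun i => (f i : ℂ)) ⊗ₖ ((d : ℂ)⁻¹ • (1 : Matrix (Fin d) (Fin d) ℂ)) := by
        rw [smul_one_eq_diagonal, diagonal_kronecker_diagonal]
      have h2 : (Q ⊗ₖ (1 : Matrix (Fin d) (Fin d) ℂ)) *
          diagonal (fun s : (Σ α, Fin (a α)) × Fin d => (f s.1 : ℂ) * (d : ℂ)⁻¹) *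
          (Q ⊗ₖ (1 : Matrix (Fin d) (Fin d) ℂ))ᴴ =
          blockDiagonal' X ⊗ₖ ((d : ℂ)⁻¹ • (1 : Matrix (Fin d) (Fin d) ℂ)) := by
        rw [h1, conjTranspose_kronecker, ← mul_kronecker_mul, ← mul_kronecker_mul, ← hs]
        simp
      calc _ = U' * (blockDiagonal' (fun α => X α ⊗ₖ
              ((d : ℂ)⁻¹ • (1 : Matrix (Fin d) (Fin d) ℂ)))).submatrix e e * U'ᴴ := by
            rw [conjTranspose_submatrix, submatrix_mul_equiv, submatrix_mul_equiv]
            rfl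
        _ = _ := by rw [hsub, ← h2, conjTranspose_mul]; simp only [Matrix.mul_assoc]
    refine ⟨Fintype.card m - Fintype.card ((Σ α, Fin (a α)) × Fin d), ?_⟩
    rw [hρ, eigenvalueMultiset_isometry_diagonal, hσ]
    · congr 1
      rw [← Finset.univ_product_univ, Finset.product_val, Multiset.bind_map]
      change Multiset.map _ (Multiset.bind _ _) = _
      rw [Multiset.map_bind]
      refine Multiset.bind_congr fun i _ => ?_
      rw [Multiset.map_map]
      simp [div_eq_mul_inv]
    · rw [conjTranspose_mul, Matrix.mul_assoc, ← Matrix.mul_assoc U'ᴴ, hU', Matrix.one_mul,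
        conjTranspose_kronecker, ← mul_kronecker_mul, hQ]
      simp

end LinearAlgebra

/-! ### Rényi entropies of spectra with `d`-fold degeneracy -/

section Entropy

variable {m k ι : Type*} [Fintype m] [DecidableEq m] [Fintype k] [DecidableEq k] [Fintype ι]

theorem Multiset.sum_map_filter_eq_sum_map_ite {α : Type*} (E : Multiset α) (p : α → Prop)
    [DecidablePred p] (g : α → ℝ) :
    ((E.filter p).map g).sum = (E.map fun z => if p z then g z else 0).sum := by
  induction E using Multiset.induction_on with
  | empty => simp
  | cons a s ih => by_cases h : p a <;> simp [h, ih]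

/-- If the spectrum of `ρ` arises from that of `σ`, a probability vector, by splitting every
eigenvalue into `d` equal parts, then all Rényi entropies increase by `log d`. -/
theorem renyiEntropy_eq_add_log {ρ : Matrix m m ℂ} {σ : Matrix k k ℂ} {d z : ℕ} (hd : 0 < d)
    (f : ι → ℝ) (hf : ∀ i, 0 ≤ f i) (hf1 : ∑ i, f i = 1)
    (hσ : eigenvalueMultiset σ = Finset.univ.val.map fun i => (f i : ℂ))
    (hρ : eigenvalueMultiset ρ = (eigenvalueMultiset σ).bind
      (fun μ => Multiset.replicate d (μ / (d : ℂ))) + Multiset.replicate z 0) (t : ℝ≥0∞) :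
    renyiEntropy t ρ = renyiEntropy t σ + Real.log d := by
  have hd0 : (0 : ℝ) < d := Nat.cast_pos.mpr hd
  have hsum : ∀ h : ℂ → ℝ, h 0 = 0 →
      ((eigenvalueMultiset ρ).map h).sum = ∑ i, (d : ℝ) * h ((f i / d : ℝ) : ℂ) := by
    intro h h0
    rw [hρ, Multiset.map_add, Multiset.sum_add, Multiset.map_bind, Multiset.sum_bind, hσ]
    simp [h0]
  have hsum' : ∀ h : ℂ → ℝ, ((eigenvalueMultiset σ).map h).sum = ∑ i, h (f i : ℂ) := by
    intro h
    rw [hσ, Multiset.map_map]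
    rfl
  have hpos : ∃ i, 0 < f i := by
    by_contra! h
    have : ∑ i, f i ≤ 0 := Finset.sum_nonpos fun i _ => h i
    linarith
  unfold renyiEntropy
  split_ifs with h1 h2
  · rw [hsum _ (by simp), hsum']
    have : ∀ i, (d : ℝ) * Real.negMulLog (((f i / d : ℝ) : ℂ)).re =
        Real.negMulLog ((f i : ℂ)).re + f i * Real.log d := by
      intro i
      rw [Complex.ofReal_re, Complex.ofReal_re, Real.negMulLog, Real.negMulLog]
      rcases eq_or_ne (f i) 0 with h | h
      · simp [h]
      · rw [Real.log_div h hd0.ne']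
        field_simp
        ring
    rw [Finset.sum_congr rfl fun i _ => this i, Finset.sum_add_distrib, ← Finset.sum_mul, hf1,
      one_mul]
  · obtain ⟨i₀, hi₀⟩ := hpos
    obtain ⟨j, -, hj⟩ := Finset.exists_max_image Finset.univ f ⟨i₀, Finset.mem_univ _⟩
    have hj0 : 0 < f j := hi₀.trans_le (hj i₀ (Finset.mem_univ _))
    have g1 : IsGreatest {x : ℝ | (x : ℂ) ∈ eigenvalueMultiset σ} (f j) := by
      rw [hσ]
      refine ⟨by simp, ?_⟩
      intro x hx
      simp only [Set.mem_ofPred_eq, Multiset.mem_map, Finset.mem_val, Finset.mem_univ, true_and,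
        Complex.ofReal_inj] at hx
      obtain ⟨i, rfl⟩ := hx
      exact hj i (Finset.mem_univ _)
    have g2 : IsGreatest {x : ℝ | (x : ℂ) ∈ eigenvalueMultiset ρ} (f j / d) := by
      have hmem : ∀ x : ℝ, (x : ℂ) ∈ eigenvalueMultiset ρ ↔
          (∃ i, f i / d = x) ∨ (z ≠ 0 ∧ x = 0) := by
        intro x
        rw [hρ, hσ]
        simp only [Multiset.mem_add, Multiset.mem_bind, Multiset.mem_map, Finset.mem_val,
          Finset.mem_univ, true_and, Multiset.mem_replicate, exists_exists_eq_and,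
          Complex.ofReal_eq_zero]
        refine or_congr (exists_congr fun i => ?_) Iff.rfl
        rw [← Complex.ofReal_natCast, ← Complex.ofReal_div, Complex.ofReal_inj]
        exact ⟨fun h => h.2.symm, fun h => ⟨hd.ne', h.symm⟩⟩
      refine ⟨(hmem _).mpr (Or.inl ⟨j, rfl⟩), ?_⟩
      intro x hx
      rcases (hmem x).mp hx with ⟨i, rfl⟩ | ⟨-, rfl⟩
      · exact div_le_div_of_nonneg_right (hj i (Finset.mem_univ _)) hd0.le
      · positivity
    rw [g1.csSup_eq, g2.csSup_eq, Real.log_div hj0.ne' hd0.ne']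
    ring
  · rw [Multiset.sum_map_filter_eq_sum_map_ite, Multiset.sum_map_filter_eq_sum_map_ite,
      hsum _ (by simp), hsum']
    set τ := t.toReal
    have hτ : 1 - τ ≠ 0 := by
      intro h
      apply h1
      have : τ = (1 : ℝ≥0∞).toReal := by simp; linarith
      exact (ENNReal.toReal_eq_toReal_iff' h2 (by simp)).mp this
    have hterm : ∀ i, (d : ℝ) * (if ((f i / d : ℝ) : ℂ) ≠ 0 then
        (((f i / d : ℝ) : ℂ)).re ^ τ else 0) =
        (d : ℝ) ^ (1 - τ) * (if (f i : ℂ) ≠ 0 then (f i : ℂ).re ^ τ else 0) := by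
      intro i
      rcases eq_or_ne (f i) 0 with h | h
      · simp [h]
      · rw [if_pos (by exact_mod_cast div_ne_zero h hd0.ne'), if_pos (by exact_mod_cast h),
          Complex.ofReal_re, Complex.ofReal_re, Real.div_rpow (hf i) hd0.le,
          Real.rpow_sub hd0, Real.rpow_one]
        field_simp
    have hS : 0 < ∑ i, (if (f i : ℂ) ≠ 0 then (f i : ℂ).re ^ τ else 0) := by
      obtain ⟨i, hi⟩ := hpos
      refine Finset.sum_pos' (fun j _ => ?_) ⟨i, Finset.mem_univ _, ?_⟩
      · split_ifs
        · exact Real.rpow_nonneg (by simpa using hf j) _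
        · exact le_rfl
      · rw [if_pos (by exact_mod_cast hi.ne'), Complex.ofReal_re]
        exact Real.rpow_pos_of_pos hi _
    rw [Finset.sum_congr rfl fun i _ => hterm i, ← Finset.mul_sum,
      Real.log_mul (Real.rpow_pos_of_pos hd0 _).ne' hS.ne', Real.log_rpow hd0]
    field_simp
    ring

/-- The maximally mixed state of dimension `d` has all Rényi entropies equal to `log d`. -/
theorem renyiEntropy_maximallyMixed {d : ℕ} (hd : 0 < d) (t : ℝ≥0∞) :
    renyiEntropy t ((d : ℂ)⁻¹ • (1 : Matrix (Fin d) (Fin d) ℂ)) = Real.log d := by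
  have h1 : ∀ (e : ℕ) (c : ℂ), eigenvalueMultiset (c • (1 : Matrix (Fin e) (Fin e) ℂ)) =
      Multiset.replicate e c := by
    intro e c
    have := eigenvalueMultiset_isometry_diagonal (Y := (1 : Matrix (Fin e) (Fin e) ℂ))
      (by simp) fun _ => c
    rw [smul_one_eq_diagonal]
    simpa using this
  -- the one-dimensional state `1` has entropy zero, and its eigenvalue splits into `d` parts
  have h2 : eigenvalueMultiset (1 : Matrix (Fin 1) (Fin 1) ℂ) = {1} := by
    simpa using h1 1 1
  have h3 : renyiEntropy t (1 : Matrix (Fin 1) (Fin 1) ℂ) = 0 := by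
    unfold renyiEntropy
    rw [h2]
    split_ifs
    · simp
    · simp
    · simp [Multiset.filter_singleton]
  rw [renyiEntropy_eq_add_log (σ := (1 : Matrix (Fin 1) (Fin 1) ℂ)) (z := 0) hd
    (fun _ : Fin 1 => 1) (by simp) (by simp) (by simp [h2]) (by simp [h1, h2]) t, h3, zero_add]

end Entropy

/-! ### Isotypic projections of a maximal commutative subgroup -/

section CharProj

/-- Orthogonality of the characters of a finite commutative group, summed over the dual. -/
theorem sum_monoidHom_apply {H : Type*} [CommGroup H] [Finite H] [Fintype (H →* ℂˣ)]
    [DecidableEq H] (a : H) :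
    ∑ χ : H →* ℂˣ, (χ a : ℂ) = if a = 1 then (Nat.card H : ℂ) else 0 := by
  split_ifs with h
  · subst h
    simp [← CommGroup.card_monoidHom_of_hasEnoughRootsOfUnity H ℂ, Nat.card_eq_fintype_card]
  · obtain ⟨φ, hφ⟩ := CommGroup.exists_apply_ne_one_of_hasEnoughRootsOfUnity H ℂ h
    have h1 : ∑ χ : H →* ℂˣ, (χ a : ℂ) = (φ a : ℂ) * ∑ χ : H →* ℂˣ, (χ a : ℂ) := by
      rw [Finset.mul_sum, ← Equiv.sum_comp (Equiv.mulLeft φ)]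
      exact Finset.sum_congr rfl fun χ _ => by simp
    by_contra h0
    apply hφ
    rw [← Units.val_eq_one]
    exact mul_right_cancel₀ h0 (h1.symm.trans (one_mul _).symm)

variable {m : Type*} [Fintype m] [DecidableEq m] {G : Type*} [Group G]

/-- For a finite subgroup `K`, the projection onto the simultaneous eigenspace of the operators
`R k`, `k ∈ K`, with eigenvalues `(χ k)⁻¹`. -/
noncomputable def charProj (R : G →* Matrix m m ℂ) (K : Subgroup G) [Fintype K]
    (χ : K →* ℂˣ) : Matrix m m ℂ :=
  (Fintype.card K : ℂ)⁻¹ • ∑ k : K, (χ k : ℂ) • R k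

variable {R : G →* Matrix m m ℂ} {K : Subgroup G} [Fintype K] {χ χ' : K →* ℂˣ}

theorem apply_mul_charProj (k : K) :
    R k * charProj R K χ = (χ k : ℂ)⁻¹ • charProj R K χ := by
  rw [charProj, Matrix.mul_smul, smul_comm]
  congr 1
  rw [Matrix.mul_sum, Finset.smul_sum,
    ← Equiv.sum_comp (Equiv.mulLeft k) fun j : K => (χ k : ℂ)⁻¹ • (χ j : ℂ) • R j]
  refine Finset.sum_congr rfl fun j _ => ?_
  rw [Equiv.coe_mulLeft, map_mul, Units.val_mul, smul_smul, inv_mul_cancel_left₀ (χ k).ne_zero,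
    Matrix.mul_smul, Subgroup.coe_mul, map_mul]

theorem charProj_mul_apply (hKc : ∀ a ∈ K, ∀ b ∈ K, a * b = b * a) (k : K) :
    charProj R K χ * R k = (χ k : ℂ)⁻¹ • charProj R K χ := by
  rw [← apply_mul_charProj, charProj, Matrix.mul_smul, Matrix.smul_mul, Matrix.mul_sum,
    Matrix.sum_mul]
  congr 1
  refine Finset.sum_congr rfl fun j _ => ?_
  rw [Matrix.smul_mul, Matrix.mul_smul, ← map_mul, ← map_mul, hKc j j.2 k k.2]

theorem charProj_mul_self : charProj R K χ * charProj R K χ = charProj R K χ := by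
  conv_lhs => lhs; rw [charProj]
  rw [Matrix.smul_mul, Matrix.sum_mul]
  have : ∀ k : K, (χ k : ℂ) • R k * charProj R K χ = charProj R K χ := fun k => by
    rw [Matrix.smul_mul, apply_mul_charProj, smul_smul, mul_inv_cancel₀ (χ k).ne_zero, one_smul]
  simp only [this, Finset.sum_const, Finset.card_univ]
  rw [← Nat.cast_smul_eq_nsmul ℂ, smul_smul, inv_mul_cancel₀ (by simp), one_smul]

theorem charProj_mul_of_ne (hKc : ∀ a ∈ K, ∀ b ∈ K, a * b = b * a) (h : χ ≠ χ') :
    charProj R K χ * charProj R K χ' = 0 := by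
  obtain ⟨k, hk⟩ := DFunLike.ne_iff.mp h
  have h1 : (χ k : ℂ)⁻¹ • (charProj R K χ * charProj R K χ') =
      (χ' k : ℂ)⁻¹ • (charProj R K χ * charProj R K χ') := by
    rw [← Matrix.smul_mul, ← charProj_mul_apply hKc, Matrix.mul_assoc, apply_mul_charProj,
      Matrix.mul_smul]
  by_contra h0
  exact hk (Units.ext (inv_injective (smul_left_injective ℂ h0 h1)))

theorem conjTranspose_charProj (hR : ∀ k ∈ K, (R k)ᴴ = R k⁻¹) :
    (charProj R K χ)ᴴ = charProj R K χ := by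
  have hχ : ∀ k : K, star (χ k : ℂ) = ((χ k)⁻¹ : ℂˣ) := by
    intro k
    have h1 : (χ k : ℂ) ^ Fintype.card K = 1 := by
      rw [← Units.val_pow_eq_pow_val, ← map_pow, pow_card_eq_one, map_one, Units.val_one]
    rw [Units.val_inv_eq_inv_val, Complex.inv_def, Complex.normSq_eq_norm_sq,
      Complex.norm_eq_one_of_pow_eq_one h1 Fintype.card_ne_zero]
    simp
  rw [charProj, conjTranspose_smul, conjTranspose_sum]
  congr 1
  · simp
  · rw [← Equiv.sum_comp (Equiv.inv K) fun j : K => (χ j : ℂ) • R j]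
    refine Finset.sum_congr rfl fun j _ => ?_
    rw [conjTranspose_smul, hR j j.2, Equiv.inv_apply, hχ, map_inv χ, Subgroup.coe_inv]

theorem sum_charProj [Fintype (K →* ℂˣ)] (hKc : ∀ a ∈ K, ∀ b ∈ K, a * b = b * a) :
    ∑ χ : K →* ℂˣ, charProj R K χ = 1 := by
  classical
  let : CommGroup K :=
    { K.toGroup with mul_comm := fun a b => Subtype.ext (hKc a a.2 b b.2) }
  have h : ∀ k : K, ∑ χ : K →* ℂˣ, (χ k : ℂ) = if k = 1 then (Nat.card K : ℂ) else 0 :=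
    fun k => sum_monoidHom_apply k
  simp only [charProj]
  rw [← Finset.smul_sum, Finset.sum_comm]
  simp only [← Finset.sum_smul, h, ite_smul, zero_smul]
  rw [Finset.sum_ite_eq' Finset.univ (1 : K)]
  simp [smul_smul, Nat.card_eq_fintype_card]

theorem charProj_mem {M : Submodule ℂ (Matrix m m ℂ)} (h : ∀ k ∈ K, R k ∈ M) :
    charProj R K χ ∈ M :=
  M.smul_mem _ (M.sum_mem fun k _ => M.smul_mem _ (h k k.2))

variable {z : G}

/-- An element outside a maximal commutative subgroup `K` anticommutes with some `k ∈ K`, so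
it has no diagonal part on the eigenspaces of `K`. Hence the projections are minimal. -/
theorem exists_charProj_mul_apply_mul_charProj (hKc : ∀ a ∈ K, ∀ b ∈ K, a * b = b * a)
    (hcomm : ∀ g h : G, g * h = h * g ∨ g * h = z * (h * g))
    (hK : ∀ g, (∀ k ∈ K, g * k = k * g) → g ∈ K) (hRz : R z = -1) (g : G) :
    ∃ c : ℂ, charProj R K χ * R g * charProj R K χ = c • charProj R K χ := by
  by_cases hg : g ∈ K
  · refine ⟨(χ ⟨g, hg⟩ : ℂ)⁻¹, ?_⟩
    rw [charProj_mul_apply hKc (⟨g, hg⟩ : K), Matrix.smul_mul, charProj_mul_self]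
  · obtain ⟨k, hk, hgk⟩ : ∃ k ∈ K, g * k ≠ k * g := by
      by_contra! h
      exact hg (hK g h)
    refine ⟨0, ?_⟩
    rw [zero_smul]
    have h1 : R g * R k = -(R k * R g) := by
      rw [← map_mul, (hcomm g k).resolve_left hgk, map_mul, hRz, map_mul, neg_one_mul]
    set p := charProj R K χ
    set c := (χ ⟨k, hk⟩ : ℂ)⁻¹
    have e1 : R k * p = c • p := apply_mul_charProj (⟨k, hk⟩ : K)
    have e2 : p * R k = c • p := charProj_mul_apply hKc (⟨k, hk⟩ : K)
    have hc : c ≠ 0 := inv_ne_zero (χ _).ne_zero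
    have h2 : c • (p * R g * p) = -(c • (p * R g * p)) := by
      calc c • (p * R g * p) = p * (R g * R k) * p := by
            rw [← Matrix.mul_smul, ← e1]; simp only [Matrix.mul_assoc]
        _ = -((p * R k) * R g * p) := by
            rw [h1, Matrix.mul_neg, Matrix.neg_mul]; simp only [Matrix.mul_assoc]
        _ = _ := by rw [e2, Matrix.smul_mul, Matrix.smul_mul]
    have h3 : (2 : ℂ) • c • (p * R g * p) = 0 := by
      rw [two_smul]
      nth_rewrite 1 [h2]
      exact neg_add_cancel _
    exact (smul_eq_zero.mp ((smul_eq_zero.mp h3).resolve_left two_ne_zero)).resolve_left hc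

theorem exists_charProj_mul_mul_charProj (hKc : ∀ a ∈ K, ∀ b ∈ K, a * b = b * a)
    (hcomm : ∀ g h : G, g * h = h * g ∨ g * h = z * (h * g))
    (hK : ∀ g, (∀ k ∈ K, g * k = k * g) → g ∈ K) (hRz : R z = -1) {X : Matrix m m ℂ}
    (hX : X ∈ Submodule.span ℂ (Set.range R)) :
    ∃ c : ℂ, charProj R K χ * X * charProj R K χ = c • charProj R K χ := by
  induction hX using Submodule.span_induction with
  | mem X h =>
    obtain ⟨g, rfl⟩ := h
    exact exists_charProj_mul_apply_mul_charProj hKc hcomm hK hRz g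
  | zero => exact ⟨0, by simp⟩
  | add X Y _ _ hX hY =>
    obtain ⟨c, hc⟩ := hX
    obtain ⟨c', hc'⟩ := hY
    refine ⟨c + c', ?_⟩
    rw [add_smul, ← hc, ← hc', Matrix.mul_add, Matrix.add_mul]
  | smul a X _ hX =>
    obtain ⟨c, hc⟩ := hX
    refine ⟨a * c, ?_⟩
    rw [mul_smul, ← hc, Matrix.mul_smul, Matrix.smul_mul]

/-- Conjugation by `R g` permutes the eigenspaces of `K`. -/
theorem exists_apply_mul_charProj_mul_apply_inv (hz : ∀ g, z * g = g * z)
    (hcomm : ∀ g h : G, g * h = h * g ∨ g * h = z * (h * g))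
    (hK : ∀ g, (∀ k ∈ K, g * k = k * g) → g ∈ K) (χ : K →* ℂˣ) (g : G) :
    ∃ χ' : K →* ℂˣ, R g * charProj R K χ * R g⁻¹ = charProj R K χ' := by
  classical
  have hzK : z ∈ K := hK z fun k _ => hz k
  have hN : K.Normal := by
    refine ⟨fun k hk g => ?_⟩
    rcases hcomm g k with h | h
    · rwa [h, mul_inv_cancel_right]
    · rw [h, mul_assoc, mul_inv_cancel_right]
      exact K.mul_mem hzK hk
  let e : K ≃* K := MulAut.conjNormal g
  refine ⟨χ.comp e.symm.toMonoidHom, ?_⟩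
  rw [charProj, charProj, Matrix.mul_smul, Matrix.smul_mul]
  congr 1
  rw [Matrix.mul_sum, Matrix.sum_mul, ← Equiv.sum_comp e.toEquiv
    fun k : K => ((χ.comp e.symm.toMonoidHom k : ℂˣ) : ℂ) • R k]
  refine Finset.sum_congr rfl fun k _ => ?_
  have h1 : ((e.toEquiv k : K) : G) = g * k * g⁻¹ := MulAut.conjNormal_apply g k
  rw [h1, map_mul, map_mul, Matrix.mul_smul, Matrix.smul_mul]
  congr 1
  change (χ k : ℂ) = (χ (e.symm (e k)) : ℂ)
  rw [e.symm_apply_apply]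

open Classical in
/-- If every `R k` is scalar or traceless then all nonzero eigenspaces of `K` have the same
dimension, since the right-hand side does not involve `χ`. -/
theorem trace_charProj (hR : ∀ k ∈ K, (∃ c : ℂ, R k = c • 1) ∨ (R k).trace = 0)
    (h0 : charProj R K χ ≠ 0) :
    (charProj R K χ).trace =
      (Fintype.card K : ℂ)⁻¹ *
        ∑ k : K, if ∃ c : ℂ, R k = c • 1 then (Fintype.card m : ℂ) else 0 := by
  rw [charProj, trace_smul, trace_sum, smul_eq_mul]
  congr 1
  refine Finset.sum_congr rfl fun k _ => ?_
  split_ifs with h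
  · obtain ⟨c, hc⟩ := h
    have h1 := apply_mul_charProj (R := R) (χ := χ) k
    rw [hc, Matrix.smul_mul, Matrix.one_mul] at h1
    have h2 : c = (χ k : ℂ)⁻¹ := smul_left_injective ℂ h0 h1
    rw [hc, trace_smul, trace_smul, trace_one, h2, smul_smul,
      mul_inv_cancel₀ (χ k).ne_zero, one_smul]
  · rw [trace_smul, (hR k k.2).resolve_left h, smul_zero]

/-- A finite group has a commutative subgroup that is its own centralizer. -/
theorem exists_maximal_commutative_subgroup (G : Type*) [Group G] [Finite G] :
    ∃ K : Subgroup G, (∀ a ∈ K, ∀ b ∈ K, a * b = b * a) ∧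
      ∀ g, (∀ k ∈ K, g * k = k * g) → g ∈ K := by
  obtain ⟨K, hK, hmax⟩ :=
    (Set.toFinite {K : Subgroup G | ∀ a ∈ K, ∀ b ∈ K, a * b = b * a}).exists_maximal
      ⟨⊥, by simp⟩
  refine ⟨K, hK, fun g hg => ?_⟩
  have h1 : IsMulCommutative (Subgroup.closure (insert g (K : Set G))) := by
    apply Subgroup.isMulCommutative_closure
    rintro a (rfl | ha) b (rfl | hb)
    · rfl
    · exact hg b hb
    · exact (hg a ha).symm
    · exact hK a ha b hb
  have h2 : K ≤ Subgroup.closure (insert g (K : Set G)) := fun k hk =>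
    Subgroup.subset_closure (Or.inr hk)
  refine hmax (fun a ha b hb => ?_) h2 (Subgroup.subset_closure (Or.inl rfl))
  exact congrArg Subtype.val (mul_comm'
    (⟨a, ha⟩ : Subgroup.closure (insert g (K : Set G))) ⟨b, hb⟩)

end CharProj

/-! ### Existence of block decompositions -/

section BlockExistence

variable {κ : Type*} [Fintype κ] [DecidableEq κ] {G : Type*} [Group G]

/-- The algebra spanned by a unitary representation of a group whose elements commute up
to a central sign has a block decomposition. The blocks are the orbits of the eigenspaces of a
maximal commutative subgroup `K` under conjugation, and the elements moving a representative
eigenspace to the other members of its orbit provide the matrix units. -/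
theorem nonempty_blockDecomposition_of_span {M : Subalgebra ℂ (Matrix κ κ ℂ)}
    {R : G →* Matrix κ κ ℂ} (hR : ∀ g, (R g)ᴴ = R g⁻¹)
    (hM : Subalgebra.toSubmodule M = Submodule.span ℂ (Set.range R))
    {K : Subgroup G} [Fintype K] (hKc : ∀ a ∈ K, ∀ b ∈ K, a * b = b * a) {z : G}
    (hz : ∀ g, z * g = g * z) (hcomm : ∀ g h : G, g * h = h * g ∨ g * h = z * (h * g))
    (hK : ∀ g, (∀ k ∈ K, g * k = k * g) → g ∈ K) (hRz : R z = -1) :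
    Nonempty (BlockDecomposition M) := by
  classical
  have hfin : Fintype (K →* ℂˣ) := Fintype.ofFinite _
  have hRinv : ∀ g, R g⁻¹ * R g = 1 := fun g => by rw [← map_mul, inv_mul_cancel, map_one]
  have hRM : ∀ g, R g ∈ M := fun g => by
    have : R g ∈ Subalgebra.toSubmodule M := hM ▸ Submodule.subset_span ⟨g, rfl⟩
    exact this
  let ι := {χ : K →* ℂˣ // charProj R K χ ≠ 0}
  let p : ι → Matrix κ κ ℂ := fun χ => charProj R K χ.1
  have hpM : ∀ χ, p χ ∈ M := fun χ =>
    charProj_mem (M := Subalgebra.toSubmodule M) fun k _ => hRM k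
  have hpH : ∀ χ, (p χ)ᴴ = p χ := fun χ => conjTranspose_charProj fun k _ => hR k
  have hpp : ∀ χ, p χ * p χ = p χ := fun χ => charProj_mul_self
  have hpne : ∀ χ χ', χ ≠ χ' → p χ * p χ' = 0 := fun χ χ' h =>
    charProj_mul_of_ne hKc fun h' => h (Subtype.ext h')
  have hconj : ∀ (χ : ι) (g : G), ∃ χ' : ι, R g * p χ * R g⁻¹ = p χ' := by
    intro χ g
    obtain ⟨χ', h⟩ := exists_apply_mul_charProj_mul_apply_inv (R := R) hz hcomm hK χ.1 g
    refine ⟨⟨χ', fun h0 => χ.2 ?_⟩, h⟩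
    rw [h0] at h
    calc charProj R K χ.1 = (R g⁻¹ * R g) * charProj R K χ.1 * (R g⁻¹ * R g) := by
          rw [hRinv, Matrix.one_mul, Matrix.mul_one]
      _ = R g⁻¹ * (R g * charProj R K χ.1 * R g⁻¹) * R g := by simp only [Matrix.mul_assoc]
      _ = 0 := by rw [h, Matrix.mul_zero, Matrix.zero_mul]
  -- eigenspaces are equivalent if some group element moves one to the other
  let s : Setoid ι :=
    { r := fun χ χ' => ∃ g, R g * p χ * R g⁻¹ = p χ'
      iseqv :=
        { refl := fun χ => ⟨1, by simp⟩
          symm := by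
            rintro χ χ' ⟨g, hg⟩
            refine ⟨g⁻¹, ?_⟩
            rw [← hg, inv_inv]
            calc _ = (R g⁻¹ * R g) * p χ * (R g⁻¹ * R g) := by simp only [Matrix.mul_assoc]
              _ = p χ := by rw [hRinv, Matrix.one_mul, Matrix.mul_one]
          trans := by
            rintro χ χ' χ'' ⟨g, hg⟩ ⟨h, hh⟩
            refine ⟨h * g, ?_⟩
            rw [← hh, ← hg, _root_.mul_inv_rev, map_mul, map_mul]
            simp only [Matrix.mul_assoc] } }
  let e : Quotient s ≃ Fin (Fintype.card (Quotient s)) := Fintype.equivFin _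
  let rep : Fin (Fintype.card (Quotient s)) → ι := fun α => (e.symm α).out
  let f : ∀ α, Fin (Fintype.card {χ : ι // e ⟦χ⟧ = α}) ≃ {χ : ι // e ⟦χ⟧ = α} := fun α =>
    (Fintype.equivFin _).symm
  have hrel : ∀ α i, ∃ g, R g * p (rep α) * R g⁻¹ = p (f α i).1 := by
    intro α i
    have h1 : (⟦rep α⟧ : Quotient s) = ⟦(f α i).1⟧ := by
      rw [← e.apply_eq_iff_eq, (f α i).2]
      simp [rep]
    exact Quotient.exact h1
  choose g hg using hrel
  -- `y α i` maps the representative eigenspace of block `α` onto the `i`-th one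
  let y : ∀ α, Fin (Fintype.card {χ : ι // e ⟦χ⟧ = α}) → Matrix κ κ ℂ := fun α i =>
    R (g α i) * p (rep α)
  have hyM : ∀ α i, y α i ∈ M := fun α i => M.mul_mem (hRM _) (hpM _)
  have hystar : ∀ α i, (y α i)ᴴ = p (rep α) * R (g α i)⁻¹ := fun α i => by
    rw [conjTranspose_mul, hpH, hR]
  have hy2 : ∀ α i, y α i = p (f α i).1 * R (g α i) := fun α i => by
    rw [← hg, Matrix.mul_assoc _ _ (R (g α i)), hRinv, Matrix.mul_one]
  have hy : ∀ α i, (y α i)ᴴ * y α i = p (rep α) := by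
    intro α i
    rw [hystar]
    calc _ = p (rep α) * (R (g α i)⁻¹ * R (g α i)) * p (rep α) := by
          simp only [y, Matrix.mul_assoc]
      _ = _ := by rw [hRinv, Matrix.mul_one, hpp]
  have hyne : ∀ α β i i', (f α i).1 ≠ (f β i').1 → (y α i)ᴴ * y β i' = 0 := by
    intro α β i i' h
    rw [hy2, hy2, conjTranspose_mul, hpH]
    calc _ = (R (g α i))ᴴ * (p (f α i).1 * p (f β i').1) * R (g β i') := by
          simp only [Matrix.mul_assoc]
      _ = 0 := by rw [hpne _ _ h, Matrix.mul_zero, Matrix.zero_mul]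
  have hyq : ∀ α i, y α i * p (rep α) * (y α i)ᴴ = p (f α i).1 := by
    intro α i
    rw [hystar, ← hg]
    calc _ = R (g α i) * (p (rep α) * p (rep α) * p (rep α)) * R (g α i)⁻¹ := by
          simp only [y, Matrix.mul_assoc]
      _ = _ := by rw [hpp, hpp]
  have hr : ∀ α, ∃ r : ℕ, (p (rep α)).trace = r := fun α => by
    obtain ⟨r, -, -, -, h⟩ := exists_orthonormal_factor_of_projection (hpH (rep α)) (hpp _)
    exact ⟨r, h⟩
  choose r hr using hr
  obtain ⟨W, hW1, hW2, hW3⟩ := exists_isometry_of_partialIsometries (fun α => p (rep α))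
    (fun α => hpH _) (fun α => hpp _) hr y hy
    (fun α i i' h => hyne α α i i' fun h' => h ((f α).injective (Subtype.ext h')))
    (fun α β i i' h => hyne α β i i' fun h' => h (by rw [← (f α i).2, h', (f β i').2]))
  have hW : W * Wᴴ = 1 := by
    have h1 := hW2 fun α => 1
    simp only [one_kronecker_one] at h1
    rw [show blockDiagonal' (fun α => (1 : Matrix (Fin (Fintype.card {χ : ι // e ⟦χ⟧ = α}) ×
      Fin (r α)) _ ℂ)) = 1 from blockDiagonal'_one, Matrix.mul_one] at h1
    have h2 : ∀ α i, ∑ i', (1 : Matrix _ _ ℂ) i i' • (y α i * p (rep α) * (y α i')ᴴ) =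
        p (f α i).1 := by
      intro α i
      rw [Finset.sum_eq_single i]
      · rw [Matrix.one_apply_eq, one_smul, hyq]
      · intro i' _ hi
        rw [Matrix.one_apply_ne hi.symm, zero_smul]
      · simp
    rw [h1]
    simp only [h2]
    calc _ = ∑ α, ∑ χ : {χ : ι // e ⟦χ⟧ = α}, p χ.1 :=
          Finset.sum_congr rfl fun α _ => Equiv.sum_comp (f α) fun χ => p χ.1
      _ = ∑ χ : ι, p χ := by
          rw [← Equiv.sum_comp (Equiv.sigmaFiberEquiv fun χ : ι => e ⟦χ⟧), Fintype.sum_sigma]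
          rfl
      _ = ∑ χ : K →* ℂˣ, charProj R K χ := by
          refine (Finset.sum_subtype (Finset.univ.filter fun χ => charProj R K χ ≠ 0)
            (p := fun χ => charProj R K χ ≠ 0) (fun χ => by simp) fun χ => charProj R K χ).symm.trans
            ?_
          exact Finset.sum_filter_ne_zero _
      _ = 1 := sum_charProj hKc
  refine ⟨⟨_, _, r, fun α => ?_, fun α => ?_, W, hW1, hW, fun X => ⟨fun hX => ?_, ?_⟩⟩⟩
  · exact Fintype.card_pos_iff.mpr ⟨⟨rep α, by simp [rep]⟩⟩
  · rcases Nat.eq_zero_or_pos (r α) with h | h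
    · exfalso
      apply (rep α).2
      have h1 := hr α
      rw [h, Nat.cast_zero, ← hpp, ← hpH] at h1
      nth_rewrite 2 [hpH] at h1
      exact trace_conjTranspose_mul_self_eq_zero_iff.mp h1
    · exact h
  · have hX' : X ∈ Submodule.span ℂ (Set.range R) := hM ▸ hX
    -- minimality of the projections makes the blocks of `X` scalar on the second factor
    have h1 : ∀ α i i', ∃ c : ℂ, p (rep α) * ((y α i)ᴴ * X * y α i') * p (rep α) =
        c • p (rep α) := by
      intro α i i'
      refine exists_charProj_mul_mul_charProj hKc hcomm hK hRz (hM ▸ ?_)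
      rw [hystar]
      exact M.mul_mem (M.mul_mem (M.mul_mem (hpM _) (hRM _)) hX) (hyM _ _)
    choose O hO using h1
    refine ⟨O, hW3 X O hO fun α β i i' hαβ => ?_⟩
    -- no group element moves an eigenspace to one in a different orbit
    clear hO hX
    induction hX' using Submodule.span_induction with
    | mem X h =>
      obtain ⟨h, rfl⟩ := h
      obtain ⟨χ', hχ'⟩ := hconj (rep β) ((g α i)⁻¹ * h * g β i')
      have hne : rep α ≠ χ' := by
        rintro rfl
        have h1 : (⟦rep β⟧ : Quotient s) = ⟦rep α⟧ := Quotient.sound ⟨_, hχ'⟩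
        apply hαβ
        simpa [rep] using h1.symm
      rw [hystar]
      calc _ = (p (rep α) * p (rep α)) * (R (g α i)⁻¹ * R h * R (g β i')) *
              (p (rep β) * p (rep β)) := by simp only [y, Matrix.mul_assoc]
        _ = p (rep α) * (R ((g α i)⁻¹ * h * g β i') * p (rep β) *
              (R ((g α i)⁻¹ * h * g β i')⁻¹ * R ((g α i)⁻¹ * h * g β i'))) := by
            rw [hpp, hpp, hRinv, map_mul, map_mul, Matrix.mul_one]; simp only [Matrix.mul_assoc]
        _ = (p (rep α) * p χ') * R ((g α i)⁻¹ * h * g β i') := by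
            rw [← hχ']; simp only [Matrix.mul_assoc]
        _ = 0 := by rw [hpne _ _ hne, Matrix.zero_mul]
    | zero => simp
    | add X Y _ _ hX hY =>
      rw [← add_zero (0 : Matrix κ κ ℂ)]
      nth_rewrite 1 [← hX]
      rw [← hY]
      simp only [Matrix.mul_add, Matrix.add_mul]
    | smul a X _ hX =>
      rw [← smul_zero a, ← hX]
      simp only [Matrix.mul_smul, Matrix.smul_mul]
  · rintro ⟨O, hO⟩
    have h1 : X = W * (Wᴴ * X * W) * Wᴴ := by
      calc X = (W * Wᴴ) * X * (W * Wᴴ) := by rw [hW, Matrix.one_mul, Matrix.mul_one]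
        _ = _ := by simp only [Matrix.mul_assoc]
    rw [h1, hO, hW2]
    refine M.sum_mem fun α _ => M.sum_mem fun i _ => M.sum_mem fun i' _ => M.smul_mem ?_ _
    rw [hystar]
    exact M.mul_mem (M.mul_mem (hyM _ _) (hpM _)) (M.mul_mem (hpM _) (hRM _))

end BlockExistence

/-! ### Pauli operators -/

section Pauli

theorem PauliLabel.trace_mat_of_ne {p : PauliLabel} (h : p ≠ .I) : p.mat.trace = 0 := by
  cases p <;> simp [PauliLabel.mat, Matrix.trace_fin_two] at h ⊢

theorem PauliLabel.conjTranspose_mat (p : PauliLabel) : p.matᴴ = p.mat := by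
  cases p <;> ext i j <;> fin_cases i <;> fin_cases j <;> simp [PauliLabel.mat]

theorem PauliLabel.exists_sign_mat_mul (p q : PauliLabel) :
    ∃ ε : ℂ, ε * ε = 1 ∧ p.mat * q.mat = ε • (q.mat * p.mat) := by
  by_cases h : p.mat * q.mat = q.mat * p.mat
  · exact ⟨1, by norm_num, by rw [h, one_smul]⟩
  · refine ⟨-1, by norm_num, ?_⟩
    cases p <;> cases q <;> first
      | exact absurd rfl h
      | (refine absurd ?_ h; simp [PauliLabel.mat]; done)
      | (ext i j; fin_cases i <;> fin_cases j <;> simp [PauliLabel.mat])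

/-- The four Pauli labels, enumerated. -/
def PauliLabel.ofFin : Fin 4 → PauliLabel := ![.I, .X, .Y, .Z]

theorem PauliLabel.exists_ofFin (p : PauliLabel) : ∃ k, PauliLabel.ofFin k = p := by
  cases p
  exacts [⟨0, rfl⟩, ⟨1, rfl⟩, ⟨2, rfl⟩, ⟨3, rfl⟩]

/-- Matrix units of a qubit are linear combinations of Pauli matrices. -/
theorem PauliLabel.exists_matrixUnit_eq_sum (a b : Fin 2) :
    ∃ c : Fin 4 → ℂ, ∀ i j, ∑ k, c k * (PauliLabel.ofFin k).mat i j =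
      if i = a ∧ j = b then 1 else 0 := by
  fin_cases a <;> fin_cases b
  · refine ⟨![1 / 2, 0, 0, 1 / 2], fun i j => ?_⟩
    fin_cases i <;> fin_cases j <;> simp [Fin.sum_univ_four, PauliLabel.ofFin, PauliLabel.mat]
    norm_num
  · refine ⟨![0, 1 / 2, Complex.I / 2, 0], fun i j => ?_⟩
    fin_cases i <;> fin_cases j <;> simp [Fin.sum_univ_four, PauliLabel.ofFin, PauliLabel.mat] <;>
      ring_nf <;> simp <;> norm_num
  · refine ⟨![0, 1 / 2, -Complex.I / 2, 0], fun i j => ?_⟩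
    fin_cases i <;> fin_cases j <;> simp [Fin.sum_univ_four, PauliLabel.ofFin, PauliLabel.mat] <;>
      ring_nf <;> simp <;> norm_num
  · refine ⟨![1 / 2, 0, 0, -1 / 2], fun i j => ?_⟩
    fin_cases i <;> fin_cases j <;> simp [Fin.sum_univ_four, PauliLabel.ofFin, PauliLabel.mat] <;>
      norm_num

/-- Pauli strings on an arbitrary finite set of qubits. -/
def pauliOp {ι : Type*} [Fintype ι] (p : ι → PauliLabel) :
    Matrix (ι → Fin 2) (ι → Fin 2) ℂ :=
  Matrix.of fun x y => ∏ i, (p i).mat (x i) (y i)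

/-- The Pauli strings span all operators, so the trace pairing with them is nondegenerate. -/
theorem eq_zero_of_trace_mul_pauliOp {ι : Type*} [Fintype ι] [DecidableEq ι]
    {Y : Matrix (ι → Fin 2) (ι → Fin 2) ℂ} (h : ∀ p, (Y * pauliOp p).trace = 0) : Y = 0 := by
  ext a b
  choose c hc using fun i => PauliLabel.exists_matrixUnit_eq_sum (b i) (a i)
  have h1 : ∀ x y : ι → Fin 2, ∑ s : ι → Fin 4, (∏ i, c i (s i)) *
      pauliOp (fun i => PauliLabel.ofFin (s i)) x y = if x = b ∧ y = a then 1 else 0 := by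
    intro x y
    have h2 : ∏ i, (∑ k, c i k * (PauliLabel.ofFin k).mat (x i) (y i)) =
        if x = b ∧ y = a then 1 else 0 := by
      simp only [hc]
      split_ifs with hxy
      · exact Finset.prod_eq_one fun i _ => by rw [hxy.1, hxy.2]; simp
      · have : ∃ i, ¬ (x i = b i ∧ y i = a i) := by
          by_contra! h3
          exact hxy ⟨funext fun i => (h3 i).1, funext fun i => (h3 i).2⟩
        obtain ⟨i, hi⟩ := this
        exact Finset.prod_eq_zero (Finset.mem_univ i) (if_neg hi)
    rw [Finset.prod_univ_sum, Fintype.piFinset_univ] at h2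
    rw [← h2]
    exact Finset.sum_congr rfl fun s _ => by rw [pauliOp, Matrix.of_apply, Finset.prod_mul_distrib]
  have h3 : ∑ s : ι → Fin 4, (∏ i, c i (s i)) *
      (Y * pauliOp fun i => PauliLabel.ofFin (s i)).trace = Y a b := by
    simp only [Matrix.trace, Matrix.diag, Matrix.mul_apply, Finset.mul_sum]
    rw [Finset.sum_comm]
    calc _ = ∑ x, ∑ y, Y x y * ∑ s : ι → Fin 4, (∏ i, c i (s i)) *
          pauliOp (fun i => PauliLabel.ofFin (s i)) y x := by
          refine Finset.sum_congr rfl fun x _ => ?_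
          rw [Finset.sum_comm]
          refine Finset.sum_congr rfl fun y _ => ?_
          rw [Finset.mul_sum]
          exact Finset.sum_congr rfl fun s _ => by ring
      _ = _ := by
          simp only [h1]
          rw [Finset.sum_eq_single a, Finset.sum_eq_single b]
          · simp
          · intro y _ hy
            simp [hy]
          · simp
          · intro x _ hx
            simp [hx]
          · simp
  rw [← h3]
  simp [h]

variable {n : ℕ}

theorem trace_pauliString {p : Fin n → PauliLabel} {i : Fin n} (hi : p i ≠ .I) :
    (pauliString p).trace = 0 := by
  have h1 : (pauliString p).trace = ∏ i, (p i).mat.trace := by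
    simp only [Matrix.trace, Matrix.diag, pauliString, Matrix.of_apply]
    rw [Finset.prod_univ_sum, Fintype.piFinset_univ]
  rw [h1]
  exact Finset.prod_eq_zero (Finset.mem_univ i) (PauliLabel.trace_mat_of_ne hi)

theorem conjTranspose_pauliString (p : Fin n → PauliLabel) :
    (pauliString p)ᴴ = pauliString p := by
  ext x y
  simp only [conjTranspose_apply, pauliString, Matrix.of_apply, star_prod]
  refine Finset.prod_congr rfl fun i _ => ?_
  rw [← conjTranspose_apply, PauliLabel.conjTranspose_mat]

theorem pauliString_mul_comm_or (p q : Fin n → PauliLabel) :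
    pauliString p * pauliString q = pauliString q * pauliString p ∨
      pauliString p * pauliString q = -(pauliString q * pauliString p) := by
  choose ε hε h using fun i => PauliLabel.exists_sign_mat_mul (p i) (q i)
  have h1 : pauliString p * pauliString q = (∏ i, ε i) • (pauliString q * pauliString p) := by
    ext x y
    rw [Matrix.smul_apply, pauliString_mul_apply, pauliString_mul_apply]
    simp only [h, Matrix.smul_apply, smul_eq_mul, Finset.prod_mul_distrib]
  have h2 : (∏ i, ε i) * (∏ i, ε i) = 1 := by
    rw [← Finset.prod_mul_distrib]
    exact Finset.prod_eq_one fun i _ => hε i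
  rcases mul_self_eq_one_iff.mp h2 with h3 | h3
  · left; rw [h1, h3, one_smul]
  · right; rw [h1, h3, neg_one_smul]

theorem mul_comm_or_of_mem_pauliGroup {u v : (QubitOp n)ˣ} (hu : u ∈ pauliGroup n)
    (hv : v ∈ pauliGroup n) :
    (u * v : QubitOp n) = v * u ∨ (u * v : QubitOp n) = -(v * u) := by
  obtain ⟨k, p, hp⟩ := hu
  obtain ⟨l, q, hq⟩ := hv
  rw [hp, hq]
  rcases pauliString_mul_comm_or p q with h | h
  · left
    rw [Matrix.smul_mul, Matrix.mul_smul, Matrix.smul_mul, Matrix.mul_smul, h, smul_comm]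
  · right
    rw [Matrix.smul_mul, Matrix.mul_smul, Matrix.smul_mul, Matrix.mul_smul, h, smul_comm,
      smul_neg, smul_neg]

theorem conjTranspose_of_mem_pauliGroup {u : (QubitOp n)ˣ} (hu : u ∈ pauliGroup n) :
    (u : QubitOp n)ᴴ = (u⁻¹ : (QubitOp n)ˣ) := by
  obtain ⟨k, p, hp⟩ := hu
  symm
  apply Units.inv_eq_of_mul_eq_one_left
  rw [hp, conjTranspose_smul, conjTranspose_pauliString, Matrix.smul_mul, Matrix.mul_smul,
    pauliString_mul_self, smul_smul, star_pow, ← mul_pow]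
  simp

theorem scalar_or_trace_eq_zero_of_mem_pauliGroup {u : (QubitOp n)ˣ} (hu : u ∈ pauliGroup n) :
    (∃ k : ℕ, (u : QubitOp n) = Complex.I ^ k • 1) ∨ (u : QubitOp n).trace = 0 := by
  obtain ⟨k, p, hp⟩ := hu
  by_cases h : ∀ i, p i = .I
  · left
    refine ⟨k, ?_⟩
    rw [hp, ← pauliString_one, show p = fun _ => .I from funext h]
  · right
    push Not at h
    obtain ⟨i, hi⟩ := h
    rw [hp, trace_smul, trace_pauliString hi, smul_zero]

theorem finite_pauliGroup (n : ℕ) : Finite (pauliGroup n) := by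
  let F : Fin 4 × (Fin n → Fin 4) → QubitOp n := fun s =>
    Complex.I ^ (s.1 : ℕ) • pauliString fun i => PauliLabel.ofFin (s.2 i)
  have h : ∀ u : pauliGroup n, ∃ s, F s = (u : (QubitOp n)ˣ) := by
    rintro ⟨u, k, p, hp⟩
    choose s hs using fun i => PauliLabel.exists_ofFin (p i)
    refine ⟨(⟨k % 4, Nat.mod_lt _ (by norm_num)⟩, s), ?_⟩
    simp only [F, hs, hp]
    rw [← Complex.I_pow_eq_pow_mod]
  choose s hs using h
  refine Finite.of_injective s fun u v huv => ?_
  apply Subtype.ext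
  apply Units.ext
  rw [← hs, ← hs, huv]

end Pauli

/-! ### Partial trace and operators supported on a subset of the qubits -/

section PartialTrace

variable {n : ℕ} (A : Finset (Fin n))

/-- The partial trace over the complement of `A`. -/
def partialTrace (Y : QubitOp n) :
    Matrix ({i // i ∈ A} → Fin 2) ({i // i ∈ A} → Fin 2) ℂ :=
  Matrix.of fun x y => ∑ z : {i // i ∉ A} → Fin 2, Y (glueBits A x z) (glueBits A y z)

/-- The operator `x ⊗ 1` acting as `x` on `A` and trivially outside `A`. -/
def extendOp (x : Matrix ({i // i ∈ A} → Fin 2) ({i // i ∈ A} → Fin 2) ℂ) : QubitOp n :=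
  Matrix.of fun a b => x (fun i => a i) (fun i => b i) *
    (1 : Matrix ({i // i ∉ A} → Fin 2) ({i // i ∉ A} → Fin 2) ℂ) (fun i => a i) fun i => b i

/-- Bit strings are pairs of a bit string on `A` and one on the complement. -/
def glueEquiv : ({i // i ∈ A} → Fin 2) × ({i // i ∉ A} → Fin 2) ≃ (Fin n → Fin 2) where
  toFun s := glueBits A s.1 s.2
  invFun a := (fun i => a i, fun i => a i)
  left_inv s := by
    ext i
    · simp [glueBits, i.2]
    · simp [glueBits, i.2]
  right_inv a := by
    ext i
    by_cases h : i ∈ A <;> simp [glueBits, h]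

theorem sum_glueBits (f : (Fin n → Fin 2) → ℂ) :
    ∑ a, f a = ∑ x, ∑ z, f (glueBits A x z) := by
  rw [← Equiv.sum_comp (glueEquiv A), Fintype.sum_prod_type]
  rfl

theorem extendOp_glueBits (x : Matrix ({i // i ∈ A} → Fin 2) ({i // i ∈ A} → Fin 2) ℂ)
    (a b z w) : extendOp A x (glueBits A a z) (glueBits A b w) = x a b * if z = w then 1 else 0 := by
  have h1 : ∀ a z, (fun i : {i // i ∈ A} => glueBits A a z i) = a := fun a z =>
    congrArg Prod.fst ((glueEquiv A).left_inv (a, z))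
  have h2 : ∀ a z, (fun i : {i // i ∉ A} => glueBits A a z i) = z := fun a z =>
    congrArg Prod.snd ((glueEquiv A).left_inv (a, z))
  rw [extendOp, Matrix.of_apply, h1, h1, h2, h2, Matrix.one_apply]

variable {A}

theorem partialTrace_extendOp_mul (x : Matrix ({i // i ∈ A} → Fin 2) ({i // i ∈ A} → Fin 2) ℂ)
    (Y : QubitOp n) : partialTrace A (extendOp A x * Y) = x * partialTrace A Y := by
  ext a b
  simp only [partialTrace, Matrix.of_apply, Matrix.mul_apply, sum_glueBits A, extendOp_glueBits]
  simp only [mul_ite, mul_one, mul_zero, ite_mul, zero_mul, Finset.sum_ite_eq, Finset.mem_univ,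
    if_true, Finset.mul_sum]
  exact Finset.sum_comm

theorem partialTrace_mul_extendOp (x : Matrix ({i // i ∈ A} → Fin 2) ({i // i ∈ A} → Fin 2) ℂ)
    (Y : QubitOp n) : partialTrace A (Y * extendOp A x) = partialTrace A Y * x := by
  ext a b
  simp only [partialTrace, Matrix.of_apply, Matrix.mul_apply, sum_glueBits A, extendOp_glueBits]
  simp only [mul_ite, mul_one, mul_zero, Finset.sum_ite_eq', Finset.mem_univ,
    if_true, Finset.sum_mul]
  exact Finset.sum_comm

theorem trace_partialTrace (Y : QubitOp n) : (partialTrace A Y).trace = Y.trace := by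
  simp only [Matrix.trace, Matrix.diag, partialTrace, Matrix.of_apply]
  rw [sum_glueBits A]

theorem conjTranspose_partialTrace (Y : QubitOp n) :
    (partialTrace A Y)ᴴ = partialTrace A Yᴴ := by
  ext a b
  simp [partialTrace, conjTranspose_apply, Matrix.of_apply, star_sum]

theorem partialTrace_add (X Y : QubitOp n) :
    partialTrace A (X + Y) = partialTrace A X + partialTrace A Y := by
  ext a b
  simp [partialTrace, Finset.sum_add_distrib]

theorem partialTrace_smul (c : ℂ) (Y : QubitOp n) :
    partialTrace A (c • Y) = c • partialTrace A Y := by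
  ext a b
  simp [partialTrace, Finset.mul_sum]

variable (A) in
/-- The partial trace as a linear map. -/
def partialTraceₗ : QubitOp n →ₗ[ℂ] Matrix ({i // i ∈ A} → Fin 2) ({i // i ∈ A} → Fin 2) ℂ where
  toFun := partialTrace A
  map_add' := partialTrace_add
  map_smul' := partialTrace_smul

theorem partialTrace_one :
    partialTrace A (1 : QubitOp n) = (2 ^ Fintype.card {i // i ∉ A} : ℂ) • 1 := by
  have h1 : extendOp A 1 = (1 : QubitOp n) := by
    ext a b
    obtain ⟨⟨x, z⟩, rfl⟩ := (glueEquiv A).surjective a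
    obtain ⟨⟨y, w⟩, rfl⟩ := (glueEquiv A).surjective b
    change extendOp A 1 (glueBits A x z) (glueBits A y w) = _
    rw [extendOp_glueBits, Matrix.one_apply, Matrix.one_apply]
    simp only [(glueEquiv A).apply_eq_iff_eq, Prod.mk.injEq]
    by_cases h : x = y <;> by_cases h' : z = w <;> simp [h, h']
  ext x y
  rw [← h1]
  simp only [partialTrace, Matrix.of_apply, extendOp_glueBits]
  simp [mul_comm]

theorem partialTrace_extendOp (x : Matrix ({i // i ∈ A} → Fin 2) ({i // i ∈ A} → Fin 2) ℂ) :
    partialTrace A (extendOp A x) = (2 ^ Fintype.card {i // i ∉ A} : ℂ) • x := by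
  have := partialTrace_extendOp_mul x 1
  rwa [Matrix.mul_one, partialTrace_one, Matrix.mul_smul, Matrix.mul_one] at this

theorem extendOp_smul (c : ℂ) (x : Matrix ({i // i ∈ A} → Fin 2) ({i // i ∈ A} → Fin 2) ℂ) :
    extendOp A (c • x) = c • extendOp A x := by
  ext a b
  simp [extendOp, mul_assoc]

theorem pauliString_eq_extendOp {p : Fin n → PauliLabel} (hp : ∀ i, i ∉ A → p i = .I) :
    pauliString p = extendOp A (pauliOp fun i : {i // i ∈ A} => p i) := by
  ext a b
  rw [pauliString, extendOp, Matrix.of_apply, Matrix.of_apply, pauliOp, Matrix.of_apply,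
    ← Fintype.prod_subtype_mul_prod_subtype fun i => i ∈ A]
  congr 1
  · exact Finset.prod_congr (by ext; simp) fun i _ => rfl
  · rw [Matrix.one_apply]
    split_ifs with h
    · exact Finset.prod_eq_one fun i _ => by
        rw [hp i i.2, show a i = b i from congrFun h i]; simp [PauliLabel.mat]
    · obtain ⟨i, hi⟩ := Function.ne_iff.mp h
      refine Finset.prod_eq_zero (Finset.mem_univ i) ?_
      rw [hp i i.2]
      exact if_neg hi

theorem partialTrace_pauliString {p : Fin n → PauliLabel} {i : Fin n} (hi : i ∉ A)
    (hp : p i ≠ .I) : partialTrace A (pauliString p) = 0 := by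
  ext a b
  have h1 : ∀ z, pauliString p (glueBits A a z) (glueBits A b z) =
      (∏ j : {j // j ∈ A}, (p j).mat (a j) (b j)) *
        ∏ j : {j // j ∉ A}, (p j).mat (z j) (z j) := by
    intro z
    rw [pauliString, Matrix.of_apply, ← Fintype.prod_subtype_mul_prod_subtype fun i => i ∈ A]
    congr 1
    · exact Finset.prod_congr (by ext; simp) fun j _ => by simp [glueBits, j.2]
    · exact Finset.prod_congr (by ext; simp) fun j _ => by simp [glueBits, j.2]
  have h2 : ∑ z : {j // j ∉ A} → Fin 2, ∏ j : {j // j ∉ A}, (p j).mat (z j) (z j) =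
      ∏ j : {j // j ∉ A}, (p j).mat.trace := by
    simp only [Matrix.trace, Matrix.diag]
    rw [Finset.prod_univ_sum, Fintype.piFinset_univ]
  rw [partialTrace, Matrix.of_apply]
  simp only [h1]
  rw [← Finset.mul_sum, h2, Finset.prod_eq_zero (Finset.mem_univ (⟨i, hi⟩ : {j // j ∉ A}))
    (PauliLabel.trace_mat_of_ne hp), mul_zero]
  rfl

end PartialTrace

/-! ### The code projection -/

section CodeProjection

variable {n : ℕ} {S : Subgroup (QubitOp n)ˣ}

theorem IsStabilizerGroup.finite (hS : IsStabilizerGroup S) : Finite S :=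
  have := finite_pauliGroup n
  Finite.of_injective _ (Subgroup.inclusion_injective hS.le_pauliGroup)

/-- The projection onto the code space, the average of the stabilizer group. -/
noncomputable def codeProj (S : Subgroup (QubitOp n)ˣ) [Fintype S] : QubitOp n :=
  charProj (Units.coeHom (QubitOp n)) S 1

variable [Fintype S]

theorem codeProj_eq_sum :
    codeProj S = (Fintype.card S : ℂ)⁻¹ • ∑ s : S, ((s : (QubitOp n)ˣ) : QubitOp n) := by
  simp [codeProj, charProj]

theorem mul_codeProj {s : (QubitOp n)ˣ} (hs : s ∈ S) : s * codeProj S = codeProj S := by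
  have := apply_mul_charProj (R := Units.coeHom (QubitOp n)) (χ := 1) (⟨s, hs⟩ : S)
  simpa [codeProj] using this

theorem codeProj_mul (hS : IsStabilizerGroup S) {s : (QubitOp n)ˣ} (hs : s ∈ S) :
    codeProj S * s = codeProj S := by
  have := charProj_mul_apply (R := Units.coeHom (QubitOp n)) (χ := 1)
    (fun a ha b hb => hS.comm a ha b hb) (⟨s, hs⟩ : S)
  simpa [codeProj] using this

theorem conjTranspose_codeProj (hS : IsStabilizerGroup S) : (codeProj S)ᴴ = codeProj S :=
  conjTranspose_charProj fun _ hk => conjTranspose_of_mem_pauliGroup (hS.le_pauliGroup hk)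

theorem codeProj_mulVec_mem (x : (Fin n → Fin 2) → ℂ) : codeProj S *ᵥ x ∈ codeSpace S := by
  intro s hs
  rw [Matrix.mulVec_mulVec, mul_codeProj hs]

theorem codeProj_mulVec {ψ : (Fin n → Fin 2) → ℂ} (hψ : ψ ∈ codeSpace S) :
    codeProj S *ᵥ ψ = ψ := by
  have h1 : ∀ s : S, ((s : (QubitOp n)ˣ) : QubitOp n) *ᵥ ψ = ψ := fun s => hψ s s.2
  rw [codeProj_eq_sum, Matrix.smul_mulVec, Matrix.sum_mulVec]
  simp only [h1, Finset.sum_const, Finset.card_univ]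
  rw [← Nat.cast_smul_eq_nsmul ℂ, smul_smul, inv_mul_cancel₀ (by simp), one_smul]

theorem commute_codeProj {P : QubitOp n} (hP : ∀ s ∈ S, Commute (s : QubitOp n) P) :
    codeProj S * P = P * codeProj S := by
  rw [codeProj_eq_sum, Matrix.smul_mul, Matrix.mul_smul, Matrix.sum_mul, Matrix.mul_sum]
  congr 1
  exact Finset.sum_congr rfl fun s _ => hP s s.2

omit [Fintype S] in
theorem IsStabilizerGroup.eq_one_of_scalar (hS : IsStabilizerGroup S) {s : (QubitOp n)ˣ}
    (hs : s ∈ S) {k : ℕ} (h : (s : QubitOp n) = Complex.I ^ k • 1) : s = 1 := by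
  set c := Complex.I ^ k
  have h4 : (c * c) * (c * c) = 1 := by
    have : c ^ 4 = 1 := by rw [← pow_mul, mul_comm, pow_mul, Complex.I_pow_four, one_pow]
    rw [← this]; ring
  have hss : ((s * s : (QubitOp n)ˣ) : QubitOp n) = (c * c) • 1 := by
    rw [Units.val_mul, h, Matrix.smul_mul, Matrix.one_mul, smul_smul]
  rcases mul_self_eq_one_iff.mp h4 with h2 | h2
  · rcases mul_self_eq_one_iff.mp h2 with h1 | h1
    · apply Units.ext
      rw [h, h1, one_smul, Units.val_one]
    · exfalso
      apply hS.neg_one_notMem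
      have : s = -1 := by
        apply Units.ext
        rw [h, h1, neg_one_smul, Units.val_neg, Units.val_one]
      rwa [← this]
  · exfalso
    apply hS.neg_one_notMem
    have : s * s = -1 := by
      apply Units.ext
      rw [hss, h2, neg_one_smul, Units.val_neg, Units.val_one]
    rw [← this]
    exact S.mul_mem hs hs

theorem trace_codeProj (hS : IsStabilizerGroup S) :
    (codeProj S).trace = 2 ^ n / (Fintype.card S : ℂ) := by
  rw [codeProj_eq_sum, trace_smul, trace_sum, Finset.sum_eq_single (1 : S)]
  · simp [div_eq_inv_mul]
  · intro s _ hs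
    refine (scalar_or_trace_eq_zero_of_mem_pauliGroup (hS.le_pauliGroup s.2)).resolve_left ?_
    rintro ⟨k, hk⟩
    exact hs (Subtype.ext (hS.eq_one_of_scalar s.2 hk))
  · simp

theorem exists_isUnitVector_smul {m : Type*} [Fintype m] {v : m → ℂ} (hv : v ≠ 0) :
    ∃ c : ℂ, IsUnitVector (c • v) := by
  have h1 : 0 < star v ⬝ᵥ v := dotProduct_star_self_pos_iff.mpr hv
  obtain ⟨r, hr0, hr⟩ : ∃ r : ℝ, 0 < r ∧ star v ⬝ᵥ v = r := by
    have h2 := Complex.pos_iff.mp h1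
    exact ⟨_, h2.1, Complex.ext rfl (by simp [← h2.2])⟩
  refine ⟨((Real.sqrt r)⁻¹ : ℝ), ?_⟩
  rw [IsUnitVector, star_smul, smul_dotProduct, dotProduct_smul, hr, smul_eq_mul, smul_eq_mul,
    Complex.star_def, Complex.conj_ofReal]
  norm_cast
  rw [← mul_assoc, ← mul_inv, Real.mul_self_sqrt hr0.le, inv_mul_cancel₀ hr0.ne']

omit [Fintype S] in
theorem IsStabilizerGroup.exists_isUnitVector_mem (hS : IsStabilizerGroup S) :
    ∃ ψ ∈ codeSpace S, IsUnitVector ψ := by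
  have := hS.finite
  have := Fintype.ofFinite S
  by_contra! h
  have h0 : ∀ ψ ∈ codeSpace S, ψ = 0 := by
    intro ψ hψ
    by_contra hne
    obtain ⟨c, hc⟩ := exists_isUnitVector_smul hne
    exact h _ ((codeSpace S).smul_mem c hψ) hc
  have h1 : codeProj S = 0 := by
    apply Matrix.toLin'.injective
    refine LinearMap.ext fun x => ?_
    rw [Matrix.toLin'_apply, h0 _ (codeProj_mulVec_mem x)]
    simp
  have h2 := trace_codeProj hS
  rw [h1, trace_zero] at h2
  have h3 : (2 : ℂ) ^ n / (Fintype.card S : ℂ) ≠ 0 :=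
    div_ne_zero (pow_ne_zero _ two_ne_zero) (by simp)
  exact h3 h2.symm

end CodeProjection

/-! ### Stabilizer states of a code -/

section StabilizerState

variable {n : ℕ} {S : Subgroup (QubitOp n)ˣ}

/-- The stabilizer of a vector in the Pauli group. -/
def pauliStabilizer (v : (Fin n → Fin 2) → ℂ) : Subgroup (QubitOp n)ˣ where
  carrier := {u | u ∈ pauliGroup n ∧ (u : QubitOp n) *ᵥ v = v}
  mul_mem' := by
    rintro a b ⟨ha, ha'⟩ ⟨hb, hb'⟩
    exact ⟨(pauliGroup n).mul_mem ha hb, by rw [Units.val_mul, ← Matrix.mulVec_mulVec, hb', ha']⟩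
  one_mem' := ⟨(pauliGroup n).one_mem, by simp⟩
  inv_mem' := by
    rintro a ⟨ha, ha'⟩
    refine ⟨(pauliGroup n).inv_mem ha, ?_⟩
    conv_lhs => rw [← ha', Matrix.mulVec_mulVec, Units.inv_mul, Matrix.one_mulVec]

theorem isStabilizerGroup_pauliStabilizer {v : (Fin n → Fin 2) → ℂ} (hv : v ≠ 0) :
    IsStabilizerGroup (pauliStabilizer v) := by
  have hne : v ≠ -v := fun h => hv (self_eq_neg.mp h)
  refine ⟨fun u hu => hu.1, fun s hs t ht => ?_, fun h => ?_⟩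
  · apply Units.ext
    rcases mul_comm_or_of_mem_pauliGroup hs.1 ht.1 with h | h
    · exact h
    · exfalso
      apply hne
      calc v = (s * t : QubitOp n) *ᵥ v := by rw [← Matrix.mulVec_mulVec, ht.2, hs.2]
        _ = -v := by rw [h, Matrix.neg_mulVec, ← Matrix.mulVec_mulVec, hs.2, ht.2]
  · have h1 := h.2
    rw [Units.val_neg, Units.val_one, Matrix.neg_mulVec, Matrix.one_mulVec] at h1
    exact hne h1.symm

/-- Among the unit vectors of the code, one whose stabilizer is as large as possible is an
eigenvector of every Pauli string commuting with its stabilizer: otherwise projecting it onto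
an eigenspace of that string would enlarge the stabilizer. -/
theorem exists_isUnitVector_mem_eigenvector (hS : IsStabilizerGroup S) :
    ∃ v ∈ codeSpace S, IsUnitVector v ∧ ∀ p : Fin n → PauliLabel,
      (∀ t ∈ pauliStabilizer v, Commute (t : QubitOp n) (pauliString p)) →
        pauliString p *ᵥ v = v ∨ pauliString p *ᵥ v = -v := by
  have hfin := finite_pauliGroup n
  have hfinS : ∀ v : (Fin n → Fin 2) → ℂ, Finite (pauliStabilizer v) := fun v =>
    Finite.of_injective _ (Subgroup.inclusion_injective (fun u hu => hu.1 :
      pauliStabilizer v ≤ pauliGroup n))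
  let D : Set ℕ := {k | ∃ v ∈ codeSpace S, IsUnitVector v ∧ Nat.card (pauliStabilizer v) = k}
  have hD : BddAbove D := by
    refine ⟨Nat.card (pauliGroup n), ?_⟩
    rintro _ ⟨v, -, -, rfl⟩
    exact Subgroup.card_le_of_le fun u hu => hu.1
  obtain ⟨ψ, hψ, hψ1⟩ := hS.exists_isUnitVector_mem
  obtain ⟨v, hv, hv1, hcard⟩ := Nat.sSup_mem (s := D) ⟨_, ψ, hψ, hψ1, rfl⟩ hD
  refine ⟨v, hv, hv1, fun p hp => ?_⟩
  set P := pauliString p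
  by_cases hw : v + P *ᵥ v = 0
  · exact Or.inr (eq_neg_of_add_eq_zero_right hw)
  · left
    obtain ⟨c, hc⟩ := exists_isUnitVector_smul hw
    have hfix : ∀ t ∈ pauliStabilizer v,
        (t : QubitOp n) *ᵥ (c • (v + P *ᵥ v)) = c • (v + P *ᵥ v) := by
      intro t ht
      rw [Matrix.mulVec_smul, Matrix.mulVec_add, Matrix.mulVec_mulVec, (hp t ht).eq,
        ← Matrix.mulVec_mulVec, ht.2]
    have hSv : S ≤ pauliStabilizer v := fun s hs => ⟨hS.le_pauliGroup hs, hv s hs⟩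
    have hle : pauliStabilizer v ≤ pauliStabilizer (c • (v + P *ᵥ v)) :=
      fun t ht => ⟨ht.1, hfix t ht⟩
    have hmax : Nat.card (pauliStabilizer (c • (v + P *ᵥ v))) ≤ Nat.card (pauliStabilizer v) := by
      rw [hcard]
      exact le_csSup hD ⟨_, fun s hs => hfix s (hSv hs), hc, rfl⟩
    have heq := Subgroup.eq_of_le_of_card_ge hle hmax
    let u : (QubitOp n)ˣ := ⟨P, P, pauliString_mul_self p, pauliString_mul_self p⟩
    have hu : u ∈ pauliStabilizer (c • (v + P *ᵥ v)) := by
      refine ⟨⟨0, p, by simp [u, P]⟩, ?_⟩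
      change P *ᵥ (c • (v + P *ᵥ v)) = _
      rw [Matrix.mulVec_smul, Matrix.mulVec_add, Matrix.mulVec_mulVec, pauliString_mul_self,
        Matrix.one_mulVec, add_comm]
    rw [← heq] at hu
    exact hu.2

/-- Every stabilizer code contains a stabilizer state: if `T` is the largest possible stabilizer
of a unit vector `v` of the code, the projection onto the code of `T` is proportional to `|v⟩⟨v|`,
so its trace `2 ^ n / |T|` is one. -/
theorem exists_isStabilizerState_mem (hS : IsStabilizerGroup S) :
    ∃ φ ∈ codeSpace S, IsStabilizerState φ := by
  obtain ⟨v, hv, hv1, hmax⟩ := exists_isUnitVector_mem_eigenvector hS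
  have hv0 : v ≠ 0 := by
    rintro rfl
    simp [IsUnitVector] at hv1
  refine ⟨v, hv, hv1, ?_⟩
  set T := pauliStabilizer v with hTdef
  have hT : IsStabilizerGroup T := isStabilizerGroup_pauliStabilizer hv0
  have := hT.finite
  have := Fintype.ofFinite T
  set τ := (codeProj T).trace with hτ
  have htr : ∀ P : QubitOp n, (vecMulVec v (star v) * P).trace = star v ⬝ᵥ (P *ᵥ v) := by
    intro P
    rw [Matrix.trace_mul_comm, Matrix.mul_vecMulVec, Matrix.trace_vecMulVec, dotProduct_comm]
  -- compare the coefficients of both sides with respect to all Pauli strings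
  have hproj : codeProj T - τ • vecMulVec v (star v) = 0 := by
    refine eq_zero_of_trace_mul_pauliOp fun p => ?_
    change ((codeProj T - τ • vecMulVec v (star v)) * pauliString p).trace = 0
    set P := pauliString p
    rw [Matrix.sub_mul, trace_sub, Matrix.smul_mul, trace_smul, htr]
    by_cases hP : ∀ t ∈ T, Commute (t : QubitOp n) P
    · have hε : ∃ k : ℕ, Complex.I ^ k * Complex.I ^ k = 1 ∧ P *ᵥ v = Complex.I ^ k • v := by
        rcases hmax p hP with h | h
        · exact ⟨0, by norm_num, by rw [h, pow_zero, one_smul]⟩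
        · exact ⟨2, by simp, by rw [h, Complex.I_sq, neg_one_smul]⟩
      obtain ⟨k, hε, hPv⟩ := hε
      have hεP : codeProj T * P = Complex.I ^ k • codeProj T := by
        have hPP : (Complex.I ^ k • P) * (Complex.I ^ k • P) = 1 := by
          rw [Matrix.smul_mul, Matrix.mul_smul, pauliString_mul_self, smul_smul, hε, one_smul]
        have hu : (⟨Complex.I ^ k • P, Complex.I ^ k • P, hPP, hPP⟩ : (QubitOp n)ˣ) ∈ T := by
          refine ⟨⟨k, p, rfl⟩, ?_⟩
          change (Complex.I ^ k • P) *ᵥ v = v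
          rw [Matrix.smul_mulVec, hPv, smul_smul, hε, one_smul]
        have h1 : codeProj T * (Complex.I ^ k • P) = codeProj T := codeProj_mul hT hu
        conv_rhs => rw [← h1]
        rw [Matrix.mul_smul, smul_smul, hε, one_smul]
      rw [hεP, trace_smul, hPv, dotProduct_smul, hv1]
      simp [hτ, mul_comm]
    · push Not at hP
      obtain ⟨t, ht, hne⟩ := hP
      have hPg : (⟨P, P, pauliString_mul_self p, pauliString_mul_self p⟩ : (QubitOp n)ˣ) ∈
        pauliGroup n := ⟨0, p, by simp [P]⟩
      have hanti : (t * P : QubitOp n) = -(P * t) :=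
        (mul_comm_or_of_mem_pauliGroup ht.1 hPg).resolve_left hne
      have h1 : (codeProj T * P).trace = -(codeProj T * P).trace := by
        calc (codeProj T * P).trace = (codeProj T * (t * P)).trace := by
              rw [← Matrix.mul_assoc, codeProj_mul hT ht]
          _ = -(codeProj T * (P * t)).trace := by rw [hanti, Matrix.mul_neg, trace_neg]
          _ = -((t * codeProj T) * P).trace := by
              rw [← Matrix.mul_assoc, Matrix.trace_mul_comm, ← Matrix.mul_assoc]
          _ = _ := by rw [mul_codeProj ht]
      have h2 : star v ⬝ᵥ (P *ᵥ v) = -(star v ⬝ᵥ (P *ᵥ v)) := by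
        have h3 : star v ᵥ* (t : QubitOp n) = star v := by
          have h4 := (T.inv_mem ht).2
          rw [← conjTranspose_of_mem_pauliGroup ht.1] at h4
          have h5 := congrArg star h4
          rwa [Matrix.star_mulVec, conjTranspose_conjTranspose] at h5
        calc star v ⬝ᵥ (P *ᵥ v) = star v ⬝ᵥ ((t * P : QubitOp n) *ᵥ v) := by
              rw [← Matrix.mulVec_mulVec, Matrix.dotProduct_mulVec _ (t : QubitOp n), h3]
          _ = _ := by
              rw [hanti, Matrix.neg_mulVec, ← Matrix.mulVec_mulVec, ht.2, dotProduct_neg]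
      rw [self_eq_neg.mp h1, self_eq_neg.mp h2]
      simp
  have hτ1 : τ = 1 := by
    have h1 : codeProj T *ᵥ v = v := codeProj_mulVec fun t ht => ht.2
    rw [sub_eq_zero.mp hproj, Matrix.smul_mulVec, Matrix.vecMulVec_mulVec, hv1] at h1
    have h2 : τ • v = (1 : ℂ) • v := by simpa using h1
    exact smul_left_injective ℂ hv0 h2
  have h3 := trace_codeProj hT
  rw [← hτ, hτ1, eq_comm, div_eq_one_iff_eq (by simp)] at h3
  have h4 : Fintype.card T = 2 ^ n := by exact_mod_cast h3.symm
  rw [← h4, ← Nat.card_eq_fintype_card]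
  rfl

end StabilizerState

/-! ### Pauli operators supported on `A` that preserve the code -/

section LocalPauli

variable {n : ℕ} (S : Subgroup (QubitOp n)ˣ) (A : Finset (Fin n))

/-- The Pauli operators, with phases, that commute with the stabilizer group and act trivially
outside `A`. -/
def localPauliGroup : Subgroup (QubitOp n)ˣ where
  carrier := {u | (∃ (k : ℕ) (p : Fin n → PauliLabel), (∀ i, i ∉ A → p i = .I) ∧
    (u : QubitOp n) = Complex.I ^ k • pauliString p) ∧ ∀ s ∈ S, s * u = u * s}
  mul_mem' := by
    rintro u v ⟨⟨k, p, hp, hu⟩, hu'⟩ ⟨⟨l, q, hq, hv⟩, hv'⟩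
    refine ⟨?_, fun s hs => by rw [← mul_assoc, hu' s hs, mul_assoc, hv' s hs, mul_assoc]⟩
    have h : ∀ i, ∃ (k : ℕ) (r : PauliLabel),
        (p i).mat * (q i).mat = Complex.I ^ k • r.mat ∧ (i ∉ A → r = .I) := by
      intro i
      by_cases hi : i ∈ A
      · obtain ⟨k, r, h⟩ := PauliLabel.exists_mat_mul (p i) (q i)
        exact ⟨k, r, h, fun h => absurd hi h⟩
      · exact ⟨0, .I, by rw [hp i hi, hq i hi]; simp [PauliLabel.mat], fun _ => rfl⟩
    choose m r hm hr using h
    refine ⟨k + l + ∑ i, m i, r, hr, ?_⟩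
    ext x y
    rw [Units.val_mul, hu, hv, Matrix.smul_mul, Matrix.mul_smul, smul_smul, Matrix.smul_apply,
      pauliString_mul_apply]
    simp only [hm, Matrix.smul_apply, smul_eq_mul, Finset.prod_mul_distrib,
      Finset.prod_pow_eq_pow_sum, pauliString, Matrix.of_apply, pow_add]
    ring
  one_mem' := ⟨⟨0, fun _ => .I, fun _ _ => rfl, by simp [pauliString_one]⟩, by simp⟩
  inv_mem' := by
    rintro u ⟨⟨k, p, hp, hu⟩, hu'⟩
    refine ⟨⟨3 * k, p, hp, ?_⟩, fun s hs => ?_⟩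
    · apply Units.inv_eq_of_mul_eq_one_right
      rw [hu, Matrix.smul_mul, Matrix.mul_smul, pauliString_mul_self, smul_smul, ← pow_add,
        show k + 3 * k = 4 * k by ring, pow_mul, Complex.I_pow_four, one_pow, one_smul]
    · rw [eq_inv_mul_iff_mul_eq, ← mul_assoc, ← hu' s hs, mul_inv_cancel_right]

variable {S A}

theorem localPauliGroup_le : localPauliGroup S A ≤ pauliGroup n := by
  rintro u ⟨⟨k, p, -, hu⟩, -⟩
  exact ⟨k, p, hu⟩

theorem pauliString_mem_localPauliGroup {p : Fin n → PauliLabel} (hp : ∀ i, i ∉ A → p i = .I)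
    (hc : ∀ s ∈ S, Commute (s : QubitOp n) (pauliString p)) :
    (⟨pauliString p, pauliString p, pauliString_mul_self p, pauliString_mul_self p⟩ :
      (QubitOp n)ˣ) ∈ localPauliGroup S A :=
  ⟨⟨0, p, hp, by simp⟩, fun s hs => Units.ext (hc s hs)⟩

theorem neg_one_mem_localPauliGroup : (-1 : (QubitOp n)ˣ) ∈ localPauliGroup S A :=
  ⟨⟨2, fun _ => .I, fun _ _ => rfl, by simp [pauliString_one]⟩, by simp⟩

theorem finite_localPauliGroup : Finite (localPauliGroup S A) :=
  have := finite_pauliGroup n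
  Finite.of_injective _ (Subgroup.inclusion_injective (localPauliGroup_le (S := S) (A := A)))

theorem mul_comm_or_of_mem_localPauliGroup (g h : localPauliGroup S A) :
    g * h = h * g ∨ g * h = ⟨-1, neg_one_mem_localPauliGroup⟩ * (h * g) := by
  rcases mul_comm_or_of_mem_pauliGroup (localPauliGroup_le g.2) (localPauliGroup_le h.2)
    with h' | h'
  · exact Or.inl (Subtype.ext (Units.ext h'))
  · refine Or.inr (Subtype.ext (Units.ext ?_))
    change (g : (QubitOp n)ˣ).val * (h : (QubitOp n)ˣ).val =
      ((-1 * (h * g : localPauliGroup S A) : (QubitOp n)ˣ) : QubitOp n)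
    rw [h']
    simp

theorem exists_eq_extendOp {u : (QubitOp n)ˣ} (hu : u ∈ localPauliGroup S A) :
    ∃ x, (u : QubitOp n) = extendOp A x := by
  obtain ⟨⟨k, p, hp, hu⟩, -⟩ := hu
  exact ⟨_, by rw [hu, pauliString_eq_extendOp hp, ← extendOp_smul]⟩

variable (S A) in
/-- The action on the qubits in `A` of the Pauli operators supported on `A`, obtained from
`Tr_{A^c} (x ⊗ 1) = 2 ^ |A^c| x`. -/
noncomputable def localRep : localPauliGroup S A →*
    Matrix ({i // i ∈ A} → Fin 2) ({i // i ∈ A} → Fin 2) ℂ where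
  toFun u := (2 ^ Fintype.card {i // i ∉ A} : ℂ)⁻¹ • partialTrace A (u : (QubitOp n)ˣ)
  map_one' := by
    change _ • partialTrace A (1 : QubitOp n) = 1
    rw [partialTrace_one, smul_smul, inv_mul_cancel₀ (pow_ne_zero _ two_ne_zero), one_smul]
  map_mul' u v := by
    obtain ⟨x, hx⟩ := exists_eq_extendOp u.2
    change _ • partialTrace A ((u : (QubitOp n)ˣ) * (v : (QubitOp n)ˣ) : QubitOp n) = _
    rw [hx, partialTrace_extendOp_mul, partialTrace_extendOp, smul_smul,
      inv_mul_cancel₀ (pow_ne_zero _ two_ne_zero), one_smul, Matrix.mul_smul]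

theorem localRep_apply (u : localPauliGroup S A) : localRep S A u =
    (2 ^ Fintype.card {i // i ∉ A} : ℂ)⁻¹ • partialTrace A (u : (QubitOp n)ˣ) := rfl

theorem extendOp_localRep (u : localPauliGroup S A) :
    extendOp A (localRep S A u) = (u : (QubitOp n)ˣ) := by
  obtain ⟨x, hx⟩ := exists_eq_extendOp u.2
  rw [localRep_apply, hx, partialTrace_extendOp, smul_smul,
      inv_mul_cancel₀ (pow_ne_zero _ two_ne_zero), one_smul]

theorem conjTranspose_localRep (u : localPauliGroup S A) :
    (localRep S A u)ᴴ = localRep S A u⁻¹ := by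
  rw [localRep_apply, localRep_apply, conjTranspose_smul, conjTranspose_partialTrace,
    conjTranspose_of_mem_pauliGroup (localPauliGroup_le u.2)]
  congr 1
  simp

theorem localRep_neg_one : localRep S A ⟨-1, neg_one_mem_localPauliGroup⟩ = -1 := by
  have h := partialTrace_smul (A := A) (-1) (1 : QubitOp n)
  rw [partialTrace_one, neg_one_smul, neg_one_smul] at h
  rw [localRep_apply, Units.val_neg, Units.val_one, h, smul_neg, smul_smul,
    inv_mul_cancel₀ (pow_ne_zero _ two_ne_zero), one_smul]

theorem localRep_scalar_or_trace_eq_zero (u : localPauliGroup S A) :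
    (∃ c : ℂ, localRep S A u = c • 1) ∨ (localRep S A u).trace = 0 := by
  rcases scalar_or_trace_eq_zero_of_mem_pauliGroup (localPauliGroup_le u.2) with ⟨k, h⟩ | h
  · left
    refine ⟨Complex.I ^ k, ?_⟩
    rw [localRep_apply, h, partialTrace_smul, partialTrace_one, smul_comm,
      inv_smul_smul₀ (pow_ne_zero _ two_ne_zero)]
  · right
    rw [localRep_apply, trace_smul, trace_partialTrace, h, smul_zero]

/-- The degeneracy `d`: the common dimension of the simultaneous eigenspaces, on the qubits in
`A`, of a maximal commutative group of Pauli operators supported on `A` that commute with the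
stabilizer group. -/
theorem exists_trace_charProj_localRep {K : Subgroup (localPauliGroup S A)} [Fintype K]
    (hKc : ∀ a ∈ K, ∀ b ∈ K, a * b = b * a) :
    ∃ d : ℕ, 0 < d ∧ ∀ χ : K →* ℂˣ, charProj (localRep S A) K χ ≠ 0 →
      (charProj (localRep S A) K χ).trace = d := by
  have hfin : Fintype (K →* ℂˣ) := Fintype.ofFinite _
  obtain ⟨χ₀, h₀⟩ : ∃ χ : K →* ℂˣ, charProj (localRep S A) K χ ≠ 0 := by
    by_contra! h
    have h1 := sum_charProj (R := localRep S A) hKc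
    rw [Finset.sum_eq_zero fun χ _ => h χ] at h1
    exact zero_ne_one h1
  have hH := conjTranspose_charProj (R := localRep S A) (χ := χ₀)
    fun k _ => conjTranspose_localRep k
  obtain ⟨d, -, -, -, hd⟩ := exists_orthonormal_factor_of_projection hH charProj_mul_self
  refine ⟨d, Nat.pos_of_ne_zero ?_, fun χ hχ => ?_⟩
  · rintro rfl
    apply h₀
    rw [Nat.cast_zero, ← charProj_mul_self] at hd
    nth_rewrite 1 [← hH] at hd
    exact trace_conjTranspose_mul_self_eq_zero_iff.mp hd
  · rw [← hd, trace_charProj (fun k _ => localRep_scalar_or_trace_eq_zero k) hχ,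
      trace_charProj (fun k _ => localRep_scalar_or_trace_eq_zero k) h₀]

end LocalPauli

/-! ### The logical representation -/

section Encoding

variable {n : ℕ} {S : Subgroup (QubitOp n)ˣ} {A : Finset (Fin n)} {κ : Type*} [Fintype κ]
  [DecidableEq κ] {V : Matrix (Fin n → Fin 2) κ ℂ}

theorem IsEncoding.mulVec_mem (hV : IsEncoding S V) (x : κ → ℂ) : V *ᵥ x ∈ codeSpace S := by
  rw [← hV.range_eq]
  exact ⟨x, rfl⟩

theorem IsEncoding.mul_mulVec (hV : IsEncoding S V) {ψ : (Fin n → Fin 2) → ℂ}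
    (hψ : ψ ∈ codeSpace S) : (V * Vᴴ) *ᵥ ψ = ψ := by
  rw [← hV.range_eq] at hψ
  obtain ⟨x, rfl⟩ := hψ
  rw [Matrix.mulVecLin_apply, Matrix.mulVec_mulVec, Matrix.mul_assoc, hV.isometry, Matrix.mul_one]

theorem IsEncoding.mul_conjTranspose (hV : IsEncoding S V) (hS : IsStabilizerGroup S)
    [Fintype S] : V * Vᴴ = codeProj S := by
  have h1 : codeProj S * V = V := by
    apply Matrix.ext_of_mulVec_single
    intro i
    rw [← Matrix.mulVec_mulVec, codeProj_mulVec (hV.mulVec_mem _)]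
  have h2 : V * Vᴴ * codeProj S = codeProj S := by
    apply Matrix.ext_of_mulVec_single
    intro i
    rw [← Matrix.mulVec_mulVec, hV.mul_mulVec (codeProj_mulVec_mem _)]
  have h3 := congrArg conjTranspose h2
  rw [conjTranspose_mul, conjTranspose_mul, conjTranspose_conjTranspose,
    conjTranspose_codeProj hS, ← Matrix.mul_assoc, h1] at h3
  exact h3

theorem IsEncoding.mul_mul_mul (hV : IsEncoding S V) (hS : IsStabilizerGroup S)
    {P : QubitOp n} (hP : ∀ s ∈ S, Commute (s : QubitOp n) P) :
    V * (Vᴴ * P * V) = P * V := by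
  have := hS.finite
  have := Fintype.ofFinite S
  have h1 := commute_codeProj hP
  rw [← hV.mul_conjTranspose hS] at h1
  calc V * (Vᴴ * P * V) = (V * Vᴴ * P) * V := by simp only [Matrix.mul_assoc]
    _ = P * V * (Vᴴ * V) := by rw [h1]; simp only [Matrix.mul_assoc]
    _ = P * V := by rw [hV.isometry, Matrix.mul_one]

theorem IsEncoding.mul_mul_mul' (hV : IsEncoding S V) (hS : IsStabilizerGroup S)
    {P : QubitOp n} (hP : ∀ s ∈ S, Commute (s : QubitOp n) P) :
    (Vᴴ * P * V) * Vᴴ = Vᴴ * P := by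
  have := hS.finite
  have := Fintype.ofFinite S
  have h1 := commute_codeProj hP
  rw [← hV.mul_conjTranspose hS] at h1
  calc (Vᴴ * P * V) * Vᴴ = Vᴴ * (P * (V * Vᴴ)) := by simp only [Matrix.mul_assoc]
    _ = (Vᴴ * V) * Vᴴ * P := by rw [← h1]; simp only [Matrix.mul_assoc]
    _ = Vᴴ * P := by rw [hV.isometry, Matrix.one_mul]

theorem commute_of_mem_localPauliGroup (u : localPauliGroup S A) :
    ∀ s ∈ S, Commute (s : QubitOp n) (u : (QubitOp n)ˣ) := fun s hs =>
  congrArg Units.val (u.2.2 s hs)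

variable (A) in
/-- The action on the logical space of the Pauli operators supported on `A`. -/
def logicalRep (hV : IsEncoding S V) (hS : IsStabilizerGroup S) :
    localPauliGroup S A →* Matrix κ κ ℂ where
  toFun u := Vᴴ * (u : (QubitOp n)ˣ).val * V
  map_one' := by
    change Vᴴ * (1 : QubitOp n) * V = 1
    rw [Matrix.mul_one, hV.isometry]
  map_mul' u v := by
    change Vᴴ * ((u : (QubitOp n)ˣ).val * (v : (QubitOp n)ˣ).val) * V = _
    rw [Matrix.mul_assoc (Vᴴ * _) V, hV.mul_mul_mul hS (commute_of_mem_localPauliGroup v)]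
    simp only [Matrix.mul_assoc]

variable (hV : IsEncoding S V) (hS : IsStabilizerGroup S)

theorem logicalRep_apply (u : localPauliGroup S A) :
    logicalRep A hV hS u = Vᴴ * (u : (QubitOp n)ˣ).val * V := rfl

theorem conjTranspose_logicalRep (u : localPauliGroup S A) :
    (logicalRep A hV hS u)ᴴ = logicalRep A hV hS u⁻¹ := by
  rw [logicalRep_apply, logicalRep_apply, conjTranspose_mul, conjTranspose_mul,
    conjTranspose_conjTranspose, conjTranspose_of_mem_pauliGroup (localPauliGroup_le u.2),
    ← Matrix.mul_assoc]
  rfl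

theorem logicalRep_neg_one :
    logicalRep A hV hS ⟨-1, neg_one_mem_localPauliGroup⟩ = -1 := by
  rw [logicalRep_apply, Units.val_neg, Units.val_one, Matrix.mul_neg, Matrix.mul_one,
    Matrix.neg_mul, hV.isometry]

theorem toSubmodule_logicalPauliAlgebra :
    Subalgebra.toSubmodule (logicalPauliAlgebra S A V) =
      Submodule.span ℂ (Set.range (logicalRep A hV hS)) := by
  apply le_antisymm
  · rw [logicalPauliAlgebra, Algebra.adjoin_eq_span]
    apply Submodule.span_mono
    have h : Submonoid.closure {M | ∃ p : Fin n → PauliLabel, (∀ i, i ∉ A → p i = PauliLabel.I) ∧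
        (∀ s ∈ S, Commute (s : QubitOp n) (pauliString p)) ∧ M = Vᴴ * pauliString p * V} ≤
        MonoidHom.mrange (logicalRep A hV hS) := by
      rw [Submonoid.closure_le]
      rintro _ ⟨p, hp, hc, rfl⟩
      exact ⟨⟨_, pauliString_mem_localPauliGroup hp hc⟩, rfl⟩
    exact h
  · rw [Submodule.span_le]
    rintro _ ⟨⟨u, ⟨k, p, hp, hu⟩, hc⟩, rfl⟩
    have hmem : Vᴴ * pauliString p * V ∈ logicalPauliAlgebra S A V := by
      refine Algebra.subset_adjoin ⟨p, hp, fun s hs => ?_, rfl⟩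
      have h1 : (s * u : QubitOp n) = u * s := congrArg Units.val (hc s hs)
      rw [hu, Matrix.mul_smul, Matrix.smul_mul] at h1
      exact smul_right_injective _ (pow_ne_zero k Complex.I_ne_zero) h1
    change logicalRep A hV hS _ ∈ logicalPauliAlgebra S A V
    rw [logicalRep_apply, hu, Matrix.mul_smul, Matrix.smul_mul]
    exact Subalgebra.smul_mem _ hmem _

end Encoding

/-! ### Reduction of logical operators to `A` -/

section Reduce

variable {n : ℕ} {S : Subgroup (QubitOp n)ˣ} {A : Finset (Fin n)} {κ : Type*} [Fintype κ]
  [DecidableEq κ] {V : Matrix (Fin n → Fin 2) κ ℂ}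

variable (A V) in
/-- Encode a logical operator and trace out the complement of `A`. -/
def reduceMap : Matrix κ κ ℂ →ₗ[ℂ]
    Matrix ({i // i ∈ A} → Fin 2) ({i // i ∈ A} → Fin 2) ℂ where
  toFun X := partialTrace A (V * X * Vᴴ)
  map_add' X Y := by rw [Matrix.mul_add, Matrix.add_mul, partialTrace_add]
  map_smul' c X := by
    rw [Matrix.mul_smul, Matrix.smul_mul, partialTrace_smul]
    rfl

theorem reduceMap_apply (X : Matrix κ κ ℂ) :
    reduceMap A V X = partialTrace A (V * X * Vᴴ) := rfl

theorem conjTranspose_reduceMap (X : Matrix κ κ ℂ) :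
    (reduceMap A V X)ᴴ = reduceMap A V Xᴴ := by
  rw [reduceMap_apply, reduceMap_apply, conjTranspose_partialTrace, conjTranspose_mul,
    conjTranspose_mul, conjTranspose_conjTranspose, Matrix.mul_assoc]

theorem trace_reduceMap (hV : IsEncoding S V) (X : Matrix κ κ ℂ) :
    (reduceMap A V X).trace = X.trace := by
  rw [reduceMap_apply, trace_partialTrace, Matrix.trace_mul_comm, ← Matrix.mul_assoc,
    hV.isometry, Matrix.one_mul]

theorem reduceMap_eq_reducedState (hV : IsEncoding S V) {ψ : (Fin n → Fin 2) → ℂ}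
    (hψ : ψ ∈ codeSpace S) :
    reduceMap A V (Vᴴ * vecMulVec ψ (star ψ) * V) = reducedState A ψ := by
  have h1 : V * (Vᴴ * vecMulVec ψ (star ψ) * V) * Vᴴ = vecMulVec ψ (star ψ) := by
    have h2 : star ψ ᵥ* (V * Vᴴ) = star ψ := by
      have h3 := congrArg star (hV.mul_mulVec hψ)
      rwa [Matrix.star_mulVec, conjTranspose_mul, conjTranspose_conjTranspose] at h3
    calc _ = (V * Vᴴ) * vecMulVec ψ (star ψ) * (V * Vᴴ) := by simp only [Matrix.mul_assoc]
      _ = _ := by rw [Matrix.mul_vecMulVec, hV.mul_mulVec hψ, Matrix.vecMulVec_mul, h2]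
  rw [reduceMap_apply, h1]
  rfl

theorem reduceMap_logicalRep_mul (hV : IsEncoding S V) (hS : IsStabilizerGroup S)
    (u : localPauliGroup S A) (X : Matrix κ κ ℂ) :
    reduceMap A V (logicalRep A hV hS u * X) = localRep S A u * reduceMap A V X := by
  rw [reduceMap_apply, reduceMap_apply, ← partialTrace_extendOp_mul, extendOp_localRep,
    logicalRep_apply, ← Matrix.mul_assoc,
    hV.mul_mul_mul hS (commute_of_mem_localPauliGroup u)]
  simp only [Matrix.mul_assoc]

theorem reduceMap_mul_logicalRep (hV : IsEncoding S V) (hS : IsStabilizerGroup S)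
    (u : localPauliGroup S A) (X : Matrix κ κ ℂ) :
    reduceMap A V (X * logicalRep A hV hS u) = reduceMap A V X * localRep S A u := by
  rw [reduceMap_apply, reduceMap_apply, ← partialTrace_mul_extendOp, extendOp_localRep,
    logicalRep_apply, Matrix.mul_assoc V, Matrix.mul_assoc X,
    hV.mul_mul_mul' hS (commute_of_mem_localPauliGroup u)]
  simp only [Matrix.mul_assoc]

/-- A stabilizer not supported on `A` is traceless on some qubit outside `A`, hence has vanishing
partial trace. -/
theorem partialTrace_eq_zero_or_mem (hS : IsStabilizerGroup S) {s : (QubitOp n)ˣ} (hs : s ∈ S) :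
    partialTrace A (s : QubitOp n) = 0 ∨ s ∈ localPauliGroup S A := by
  obtain ⟨k, p, hp⟩ := hS.le_pauliGroup hs
  by_cases h : ∀ i, i ∉ A → p i = .I
  · exact Or.inr ⟨⟨k, p, h, hp⟩, fun t ht => hS.comm t ht s hs⟩
  · left
    push Not at h
    obtain ⟨i, hi, hpi⟩ := h
    rw [hp, partialTrace_smul, partialTrace_pauliString hi hpi, smul_zero]

theorem partialTrace_eq_smul_localRep (u : localPauliGroup S A) :
    partialTrace A (u : (QubitOp n)ˣ).val =
      (2 ^ Fintype.card {i // i ∉ A} : ℂ) • localRep S A u := by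
  rw [localRep_apply, smul_inv_smul₀ (pow_ne_zero _ two_ne_zero)]

theorem reduceMap_one (hV : IsEncoding S V) (hS : IsStabilizerGroup S) [Fintype S] :
    reduceMap A V 1 = (Fintype.card S : ℂ)⁻¹ • ∑ s : S, partialTrace A (s : (QubitOp n)ˣ).val := by
  rw [reduceMap_apply, Matrix.mul_one, hV.mul_conjTranspose hS, codeProj_eq_sum, partialTrace_smul]
  congr 1
  exact map_sum (partialTraceₗ A) _ _

theorem reduceMap_one_mem_span (hV : IsEncoding S V) (hS : IsStabilizerGroup S) :
    reduceMap A V 1 ∈ Submodule.span ℂ (Set.range (localRep S A)) := by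
  have := hS.finite
  have := Fintype.ofFinite S
  rw [reduceMap_one hV hS]
  refine Submodule.smul_mem _ _ (Submodule.sum_mem _ fun s _ => ?_)
  rcases partialTrace_eq_zero_or_mem (A := A) hS s.2 with h | h
  · rw [h]
    exact Submodule.zero_mem _
  · rw [partialTrace_eq_smul_localRep (⟨s, h⟩ : localPauliGroup S A)]
    exact Submodule.smul_mem _ _ (Submodule.subset_span ⟨_, rfl⟩)

/-- The reduction of the code projection is a multiple of a projection. -/
theorem exists_reduceMap_one_mul_self (hV : IsEncoding S V) (hS : IsStabilizerGroup S) :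
    ∃ lam : ℂ, lam ≠ 0 ∧ star lam = lam ∧
      reduceMap A V 1 * reduceMap A V 1 = lam • reduceMap A V 1 := by
  have := hS.finite
  have := Fintype.ofFinite S
  have h1 : ∀ s : S, ∃ c : ℂ, partialTrace A (s : (QubitOp n)ˣ).val * reduceMap A V 1 =
      c • reduceMap A V 1 := by
    intro s
    rcases partialTrace_eq_zero_or_mem (A := A) hS s.2 with h | h
    · exact ⟨0, by rw [h, Matrix.zero_mul, zero_smul]⟩
    · refine ⟨2 ^ Fintype.card {i // i ∉ A}, ?_⟩
      rw [partialTrace_eq_smul_localRep (⟨s, h⟩ : localPauliGroup S A), Matrix.smul_mul,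
        ← reduceMap_logicalRep_mul hV hS, Matrix.mul_one]
      have h2 : (s : (QubitOp n)ˣ).val * V = V := by
        apply Matrix.ext_of_mulVec_single
        intro i
        rw [← Matrix.mulVec_mulVec, hV.mulVec_mem _ _ s.2]
      rw [logicalRep_apply, Matrix.mul_assoc, h2, hV.isometry]
  choose c hc using h1
  have h2 : reduceMap A V 1 * reduceMap A V 1 =
      ((Fintype.card S : ℂ)⁻¹ * ∑ s, c s) • reduceMap A V 1 := by
    conv_lhs => lhs; rw [reduceMap_one hV hS]
    rw [Matrix.smul_mul, Matrix.sum_mul, mul_smul, Finset.sum_smul]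
    simp only [hc]
  have h0 : reduceMap A V 1 ≠ 0 := by
    intro h
    have h3 := trace_reduceMap (A := A) hV 1
    rw [h, trace_zero, ← hV.isometry, Matrix.trace_mul_comm, hV.mul_conjTranspose hS,
      trace_codeProj hS] at h3
    exact div_ne_zero (pow_ne_zero _ two_ne_zero) (by simp) h3.symm
  have hH : (reduceMap A V 1)ᴴ = reduceMap A V 1 := by
    rw [conjTranspose_reduceMap, conjTranspose_one]
  refine ⟨_, fun h => h0 ?_, ?_, h2⟩
  · rw [h, zero_smul] at h2
    nth_rewrite 1 [← hH] at h2
    exact conjTranspose_mul_self_eq_zero.mp h2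
  · have h3 := congrArg conjTranspose h2
    rw [conjTranspose_mul, hH, conjTranspose_smul, hH, h2] at h3
    exact (smul_left_injective ℂ h0 h3).symm

/-- The reduction map turns multiplication by an element `X` of the logical algebra, on either side,
into multiplication by one operator `x` on `A`. -/
theorem exists_reduceMap_mul (hV : IsEncoding S V) (hS : IsStabilizerGroup S)
    {X : Matrix κ κ ℂ} (hX : X ∈ logicalPauliAlgebra S A V) :
    ∃ x, ∀ Y, reduceMap A V (X * Y) = x * reduceMap A V Y ∧
      reduceMap A V (Y * X) = reduceMap A V Y * x := by
  have hX' : X ∈ Submodule.span ℂ (Set.range (logicalRep A hV hS)) := by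
    rw [← toSubmodule_logicalPauliAlgebra]
    exact hX
  clear hX
  induction hX' using Submodule.span_induction with
  | mem X h =>
    obtain ⟨u, rfl⟩ := h
    exact ⟨localRep S A u, fun Y => ⟨reduceMap_logicalRep_mul hV hS u Y,
      reduceMap_mul_logicalRep hV hS u Y⟩⟩
  | zero => exact ⟨0, fun Y => by simp⟩
  | add X X' _ _ h h' =>
    obtain ⟨x, hx⟩ := h
    obtain ⟨x', hx'⟩ := h'
    refine ⟨x + x', fun Y => ?_⟩
    rw [Matrix.add_mul, Matrix.mul_add, Matrix.add_mul, Matrix.mul_add, map_add, map_add,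
      (hx Y).1, (hx Y).2, (hx' Y).1, (hx' Y).2]
    exact ⟨rfl, rfl⟩
  | smul a X _ h =>
    obtain ⟨x, hx⟩ := h
    refine ⟨a • x, fun Y => ?_⟩
    rw [Matrix.smul_mul, Matrix.mul_smul, Matrix.smul_mul, Matrix.mul_smul, map_smul, map_smul,
      (hx Y).1, (hx Y).2]
    exact ⟨rfl, rfl⟩

/-- Up to the factor `lam`, the reduction map is multiplicative on the logical algebra. -/
theorem reduceMap_mul (hV : IsEncoding S V) (hS : IsStabilizerGroup S) {lam : ℂ}
    (hlam : reduceMap A V 1 * reduceMap A V 1 = lam • reduceMap A V 1) {X Y : Matrix κ κ ℂ}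
    (hX : X ∈ logicalPauliAlgebra S A V) (hY : Y ∈ logicalPauliAlgebra S A V) :
    reduceMap A V X * reduceMap A V Y = lam • reduceMap A V (X * Y) := by
  obtain ⟨x, hx⟩ := exists_reduceMap_mul hV hS hX
  obtain ⟨y, hy⟩ := exists_reduceMap_mul hV hS hY
  have h1 := (hx 1).1
  have h2 := (hy 1).2
  rw [Matrix.mul_one] at h1
  rw [Matrix.one_mul] at h2
  calc _ = x * (reduceMap A V 1 * reduceMap A V 1) * y := by
        rw [h1, h2]; simp only [Matrix.mul_assoc]
    _ = lam • (x * (reduceMap A V 1 * y)) := by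
        rw [hlam, Matrix.mul_smul, Matrix.smul_mul, Matrix.mul_assoc]
    _ = _ := by rw [(hx Y).1, h2]

/-- The reduction of an operator to `A` only depends on its expectation values against the
logical algebra, since a Pauli string on `A` anticommuting with a stabilizer has vanishing matrix
elements between code vectors. -/
theorem reduceMap_eq_of_trace_eq (hV : IsEncoding S V) (hS : IsStabilizerGroup S)
    {X Y : Matrix κ κ ℂ}
    (h : ∀ Z ∈ logicalPauliAlgebra S A V, (X * Z).trace = (Y * Z).trace) :
    reduceMap A V X = reduceMap A V Y := by
  rw [← sub_eq_zero, ← map_sub]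
  refine eq_zero_of_trace_mul_pauliOp fun q => ?_
  classical
  let p : Fin n → PauliLabel := fun i => if h : i ∈ A then q ⟨i, h⟩ else .I
  have hp : ∀ i, i ∉ A → p i = .I := fun i hi => dif_neg hi
  have hq : (fun i : {i // i ∈ A} => p i) = q := funext fun i => dif_pos i.2
  have h1 : (reduceMap A V (X - Y) * pauliOp q).trace =
      ((X - Y) * (Vᴴ * pauliString p * V)).trace := by
    rw [← hq, reduceMap_apply, ← partialTrace_mul_extendOp, ← pauliString_eq_extendOp hp,
      trace_partialTrace, Matrix.mul_assoc V, Matrix.mul_assoc V, Matrix.trace_mul_comm]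
    simp only [Matrix.mul_assoc]
  rw [h1, Matrix.sub_mul, trace_sub, sub_eq_zero]
  by_cases hc : ∀ s ∈ S, Commute (s : QubitOp n) (pauliString p)
  · exact h _ (Algebra.subset_adjoin ⟨p, hp, hc, rfl⟩)
  · push Not at hc
    obtain ⟨s, hs, hne⟩ := hc
    have hanti : (s * pauliString p : QubitOp n) = -(pauliString p * s) :=
      (mul_comm_or_of_mem_pauliGroup (hS.le_pauliGroup hs) (v := ⟨pauliString p, pauliString p,
        pauliString_mul_self p, pauliString_mul_self p⟩) ⟨0, p, by simp⟩).resolve_left hne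
    have hsV : ∀ s ∈ S, (s : QubitOp n) * V = V := by
      intro s hs
      apply Matrix.ext_of_mulVec_single
      intro i
      rw [← Matrix.mulVec_mulVec, hV.mulVec_mem _ _ hs]
    have hVs : Vᴴ * (s : QubitOp n) = Vᴴ := by
      have h2 := congrArg conjTranspose (hsV _ (S.inv_mem hs))
      rwa [← conjTranspose_of_mem_pauliGroup (hS.le_pauliGroup hs), conjTranspose_mul,
        conjTranspose_conjTranspose] at h2
    have h0 : Vᴴ * pauliString p * V = 0 := by
      have h3 : Vᴴ * pauliString p * V = -(Vᴴ * pauliString p * V) := by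
        calc Vᴴ * pauliString p * V = Vᴴ * (s.val * pauliString p) * V := by
              rw [← Matrix.mul_assoc, hVs]
        _ = -(Vᴴ * pauliString p * (s.val * V)) := by
            rw [hanti, Matrix.mul_neg, Matrix.neg_mul]; simp only [Matrix.mul_assoc]
        _ = _ := by rw [hsV s hs]
      ext i j
      exact self_eq_neg.mp (congrFun (congrFun h3 i) j)
    rw [h0, Matrix.mul_zero, Matrix.mul_zero]

/-- Minimal projections `e` of the logical algebra all reduce, after normalization, to projections
of the same rank `d`: the image of `e` is not orthogonal to the image of one of the isotypic
projections of `K` on the logical space, which by minimality equals the isotypic projection of `K`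
on the qubits of `A`. -/
theorem trace_reduceMap_of_minimal (hV : IsEncoding S V) (hS : IsStabilizerGroup S)
    {lam : ℂ} (hlam0 : lam ≠ 0) (hlamH : star lam = lam)
    (hlam : reduceMap A V 1 * reduceMap A V 1 = lam • reduceMap A V 1)
    {K : Subgroup (localPauliGroup S A)} [Fintype K] (hKc : ∀ a ∈ K, ∀ b ∈ K, a * b = b * a)
    (hK : ∀ g, (∀ k ∈ K, g * k = k * g) → g ∈ K) {d : ℕ}
    (hd : ∀ χ : K →* ℂˣ, charProj (localRep S A) K χ ≠ 0 →
      (charProj (localRep S A) K χ).trace = d)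
    {e : Matrix κ κ ℂ} (he : e ∈ logicalPauliAlgebra S A V) (heH : eᴴ = e) (hee : e * e = e)
    (he0 : e.trace ≠ 0)
    (hmin : ∀ X ∈ logicalPauliAlgebra S A V, ∃ c : ℂ, e * X * e = c • e) :
    (lam⁻¹ • reduceMap A V e).trace = d := by
  have hfin : Fintype (K →* ℂˣ) := Fintype.ofFinite _
  set M := logicalPauliAlgebra S A V
  set θ : Matrix κ κ ℂ →ₗ[ℂ] _ := lam⁻¹ • reduceMap A V with hθ
  have hθH : ∀ X, (θ X)ᴴ = θ Xᴴ := by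
    intro X
    rw [hθ, LinearMap.smul_apply, LinearMap.smul_apply, conjTranspose_smul,
      conjTranspose_reduceMap, star_inv₀, hlamH]
  have hθm : ∀ X ∈ M, ∀ Y ∈ M, θ X * θ Y = θ (X * Y) := by
    intro X hX Y hY
    rw [hθ, LinearMap.smul_apply, LinearMap.smul_apply, LinearMap.smul_apply, Matrix.smul_mul,
      Matrix.mul_smul, reduceMap_mul hV hS hlam hX hY, inv_smul_smul₀ hlam0]
  let p : (K →* ℂˣ) → Matrix κ κ ℂ := charProj (logicalRep A hV hS) K
  let p' := charProj (localRep S A) K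
  have hspan : ∀ X ∈ M, X ∈ Submodule.span ℂ (Set.range (logicalRep A hV hS)) := by
    intro X hX
    rw [← toSubmodule_logicalPauliAlgebra]
    exact hX
  have hpM : ∀ χ, p χ ∈ M := by
    intro χ
    refine charProj_mem (M := Subalgebra.toSubmodule M) fun k _ => ?_
    rw [toSubmodule_logicalPauliAlgebra hV hS]
    exact Submodule.subset_span ⟨k, rfl⟩
  have h1M : (1 : Matrix κ κ ℂ) ∈ M := M.one_mem
  have hpH : ∀ χ, (p χ)ᴴ = p χ := fun χ =>
    conjTranspose_charProj fun k _ => conjTranspose_logicalRep hV hS k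
  have hθp : ∀ χ, θ (p χ) = p' χ * θ 1 := by
    intro χ
    change θ (charProj _ K χ) = charProj _ K χ * θ 1
    rw [charProj, charProj, map_smul, map_sum, Matrix.smul_mul, Matrix.sum_mul]
    congr 1
    refine Finset.sum_congr rfl fun k _ => ?_
    rw [map_smul, Matrix.smul_mul, hθ, LinearMap.smul_apply, LinearMap.smul_apply,
      Matrix.mul_smul, ← reduceMap_logicalRep_mul hV hS, Matrix.mul_one]
  have hθp' : ∀ χ, θ (p χ) = θ 1 * p' χ := by
    intro χ
    change θ (charProj _ K χ) = θ 1 * charProj _ K χ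
    rw [charProj, charProj, map_smul, map_sum, Matrix.mul_smul, Matrix.mul_sum]
    congr 1
    refine Finset.sum_congr rfl fun k _ => ?_
    rw [map_smul, Matrix.mul_smul, hθ, LinearMap.smul_apply, LinearMap.smul_apply,
      Matrix.smul_mul, ← reduceMap_mul_logicalRep hV hS, Matrix.one_mul]
  have hθe : θ e ≠ 0 := by
    intro h
    apply he0
    rw [hθ, LinearMap.smul_apply, smul_eq_zero_iff_right (inv_ne_zero hlam0)] at h
    rw [← trace_reduceMap (A := A) hV, h, trace_zero]
  obtain ⟨χ, hχ⟩ : ∃ χ, θ (p χ) * θ e ≠ 0 := by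
    by_contra! h
    apply hθe
    calc θ e = θ (∑ χ, p χ) * θ e := by
          rw [show ∑ χ, p χ = 1 from sum_charProj hKc, hθm 1 h1M e he, Matrix.one_mul]
      _ = 0 := by rw [map_sum, Matrix.sum_mul, Finset.sum_eq_zero fun χ _ => h χ]
  have hp0 : θ (p χ) ≠ 0 := fun h => hχ (by rw [h, Matrix.zero_mul])
  have hpp : p χ * p χ = p χ := charProj_mul_self
  have hpp' : p' χ * p' χ = p' χ := charProj_mul_self
  have hp'0 : p' χ ≠ 0 := fun h => hp0 (by rw [hθp, h, Matrix.zero_mul])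
  -- by minimality `θ (p χ)` is a multiple of `p' χ`, and both are idempotent
  obtain ⟨c, hc⟩ : ∃ c : ℂ, θ (p χ) = c • p' χ := by
    have h1 : θ 1 ∈ Submodule.span ℂ (Set.range (localRep S A)) :=
      Submodule.smul_mem _ _ (reduceMap_one_mem_span hV hS)
    obtain ⟨c, hc⟩ := exists_charProj_mul_mul_charProj (χ := χ) hKc
      mul_comm_or_of_mem_localPauliGroup hK localRep_neg_one h1
    refine ⟨c, ?_⟩
    calc θ (p χ) = (p' χ * p' χ) * θ 1 := by rw [hpp', hθp]
      _ = p' χ * θ 1 * p' χ := by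
          rw [Matrix.mul_assoc _ (θ 1), ← hθp', hθp, ← Matrix.mul_assoc]
      _ = c • p' χ := hc
  have hc1 : θ (p χ) = p' χ := by
    have h1 := hθm _ (hpM χ) _ (hpM χ)
    rw [hpp, hc, Matrix.smul_mul, Matrix.mul_smul, hpp', smul_smul] at h1
    have h2 : c * c = c := smul_left_injective ℂ hp'0 h1
    have h3 : c ≠ 0 := by
      rintro rfl
      exact hp0 (by rw [hc, zero_smul])
    rw [hc, mul_right_cancel₀ h3 (h2.trans (one_mul c).symm), one_smul]
  obtain ⟨c₁, hc₁⟩ := hmin (p χ) (hpM χ)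
  obtain ⟨c₂, hc₂⟩ := exists_charProj_mul_mul_charProj (χ := χ) hKc
    mul_comm_or_of_mem_localPauliGroup hK (logicalRep_neg_one hV hS) (hspan e he)
  have h1 : θ e * θ (p χ) * θ e = c₁ • θ e := by
    rw [hθm _ he _ (hpM χ), hθm _ (M.mul_mem he (hpM χ)) _ he, ← map_smul]
    exact congrArg θ hc₁
  have h2 : θ (p χ) * θ e * θ (p χ) = c₂ • θ (p χ) := by
    rw [hθm _ (hpM χ) _ he, hθm _ (M.mul_mem (hpM χ) he) _ (hpM χ), ← map_smul]
    exact congrArg θ hc₂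
  have h3 := trace_eq_of_minimal (by rw [hθH, heH]) (by rw [hθH, hpH]) (by rw [hθm _ he _ he, hee])
    (by rw [hθm _ (hpM χ) _ (hpM χ), hpp]) h1 h2 hχ
  have h4 : (θ e).trace = d := by rw [h3, hc1, hd χ hp'0]
  exact h4

end Reduce

/-! ### Operators adapted to a block decomposition -/

namespace BlockDecomposition

variable {κ : Type*} [Fintype κ] [DecidableEq κ] {M : Subalgebra ℂ (Matrix κ κ ℂ)}
  (B : BlockDecomposition M)

/-- The element `⨁ O α ⊗ 1` of the algebra. -/
def blockOp : (∀ α, Matrix (Fin (B.dimA α)) (Fin (B.dimA α)) ℂ) →ₗ[ℂ] Matrix κ κ ℂ where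
  toFun O := B.W * blockDiagonal' (fun α => O α ⊗ₖ
    (1 : Matrix (Fin (B.dimAc α)) (Fin (B.dimAc α)) ℂ)) * B.Wᴴ
  map_add' O O' := by
    rw [← Matrix.add_mul, ← Matrix.mul_add, ← blockDiagonal'_add]
    congr 3
    funext α
    exact add_kronecker _ _ _
  map_smul' c O := by
    rw [RingHom.id_apply, ← Matrix.smul_mul, ← Matrix.mul_smul, ← blockDiagonal'_smul]
    congr 3
    funext α
    exact smul_kronecker c (O α) 1

theorem blockOp_apply (O : ∀ α, Matrix (Fin (B.dimA α)) (Fin (B.dimA α)) ℂ) :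
    B.blockOp O = B.W * blockDiagonal' (fun α => O α ⊗ₖ
      (1 : Matrix (Fin (B.dimAc α)) (Fin (B.dimAc α)) ℂ)) * B.Wᴴ := rfl

theorem conj_blockOp (O : ∀ α, Matrix (Fin (B.dimA α)) (Fin (B.dimA α)) ℂ) :
    B.Wᴴ * B.blockOp O * B.W = blockDiagonal' (fun α => O α ⊗ₖ
      (1 : Matrix (Fin (B.dimAc α)) (Fin (B.dimAc α)) ℂ)) := by
  rw [blockOp_apply]
  calc _ = (B.Wᴴ * B.W) * blockDiagonal' (fun α => O α ⊗ₖ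
      (1 : Matrix (Fin (B.dimAc α)) (Fin (B.dimAc α)) ℂ)) * (B.Wᴴ * B.W) := by
        simp only [Matrix.mul_assoc]
    _ = _ := by rw [B.isometry, Matrix.one_mul, Matrix.mul_one]

theorem blockOp_mem (O : ∀ α, Matrix (Fin (B.dimA α)) (Fin (B.dimA α)) ℂ) : B.blockOp O ∈ M :=
  (B.mem_iff _).mpr ⟨O, B.conj_blockOp O⟩

theorem exists_eq_blockOp {X : Matrix κ κ ℂ} (hX : X ∈ M) : ∃ O, X = B.blockOp O := by
  obtain ⟨O, hO⟩ := (B.mem_iff X).mp hX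
  refine ⟨O, ?_⟩
  rw [blockOp_apply, ← hO]
  calc X = (B.W * B.Wᴴ) * X * (B.W * B.Wᴴ) := by
        rw [B.unitary, Matrix.one_mul, Matrix.mul_one]
    _ = _ := by simp only [Matrix.mul_assoc]

theorem blockOp_mul (O O' : ∀ α, Matrix (Fin (B.dimA α)) (Fin (B.dimA α)) ℂ) :
    B.blockOp O * B.blockOp O' = B.blockOp (fun α => O α * O' α) := by
  have h : blockDiagonal' (fun α => (O α * O' α) ⊗ₖ
      (1 : Matrix (Fin (B.dimAc α)) (Fin (B.dimAc α)) ℂ)) =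
      blockDiagonal' (fun α => O α ⊗ₖ (1 : Matrix (Fin (B.dimAc α)) (Fin (B.dimAc α)) ℂ)) *
      blockDiagonal' (fun α => O' α ⊗ₖ (1 : Matrix (Fin (B.dimAc α)) (Fin (B.dimAc α)) ℂ)) := by
    rw [← blockDiagonal'_mul]
    congr 1
    funext α
    rw [← mul_kronecker_mul, Matrix.one_mul]
  rw [blockOp_apply B fun α => O α * O' α, h, ← conj_blockOp B O, blockOp_apply B O']
  calc _ = (B.W * B.Wᴴ) * B.blockOp O * (B.W * blockDiagonal' (fun α => O' α ⊗ₖ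
      (1 : Matrix (Fin (B.dimAc α)) (Fin (B.dimAc α)) ℂ)) * B.Wᴴ) := by
        rw [B.unitary, Matrix.one_mul]
    _ = _ := by simp only [Matrix.mul_assoc]

theorem conjTranspose_blockOp (O : ∀ α, Matrix (Fin (B.dimA α)) (Fin (B.dimA α)) ℂ) :
    (B.blockOp O)ᴴ = B.blockOp fun α => (O α)ᴴ := by
  rw [blockOp_apply, blockOp_apply, conjTranspose_mul, conjTranspose_mul,
    conjTranspose_conjTranspose, blockDiagonal'_conjTranspose, Matrix.mul_assoc]
  simp only [conjTranspose_kronecker, conjTranspose_one]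

/-- The trace pairing of an operator with `⨁ O α ⊗ 1` only sees its partial traces. -/
theorem trace_mul_blockOp (X : Matrix κ κ ℂ)
    (O : ∀ α, Matrix (Fin (B.dimA α)) (Fin (B.dimA α)) ℂ) :
    (X * B.blockOp O).trace = ∑ α, ∑ i, ∑ i',
      (∑ j, (B.Wᴴ * X * B.W) ⟨α, (i, j)⟩ ⟨α, (i', j)⟩) * O α i' i := by
  have h1 : (X * B.blockOp O).trace = ((B.Wᴴ * X * B.W) * blockDiagonal' (fun α => O α ⊗ₖ
      (1 : Matrix (Fin (B.dimAc α)) (Fin (B.dimAc α)) ℂ))).trace := by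
    rw [blockOp_apply, ← Matrix.mul_assoc, Matrix.trace_mul_comm]
    simp only [Matrix.mul_assoc]
  rw [h1]
  simp only [Matrix.trace, Matrix.diag, Fintype.sum_sigma, Fintype.sum_prod_type]
  refine Finset.sum_congr rfl fun α _ => Finset.sum_congr rfl fun i _ => ?_
  have h2 : ∀ j, ((B.Wᴴ * X * B.W) * blockDiagonal' (fun α => O α ⊗ₖ
      (1 : Matrix (Fin (B.dimAc α)) (Fin (B.dimAc α)) ℂ))) ⟨α, (i, j)⟩ ⟨α, (i, j)⟩ =
      ∑ i', (B.Wᴴ * X * B.W) ⟨α, (i, j)⟩ ⟨α, (i', j)⟩ * O α i' i := by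
    intro j
    rw [Matrix.mul_apply, Fintype.sum_sigma, Finset.sum_eq_single α]
    · simp only [Fintype.sum_prod_type, blockDiagonal'_apply_eq, kronecker_apply,
        Matrix.one_apply]
      simp
    · intro β _ hβ
      refine Finset.sum_eq_zero fun t _ => ?_
      rw [blockDiagonal'_apply_ne _ _ _ hβ, mul_zero]
    · simp
  simp only [h2]
  rw [Finset.sum_comm]
  exact Finset.sum_congr rfl fun i' _ => (Finset.sum_mul _ _ _).symm

/-- The matrix unit `|i⟩⟨i'|` in block `α`. -/
def blockUnit (α : Fin B.numBlocks) (i i' : Fin (B.dimA α)) :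
    ∀ β, Matrix (Fin (B.dimA β)) (Fin (B.dimA β)) ℂ :=
  Pi.single α (Matrix.single i i' 1)

theorem blockUnit_mul_blockUnit (α : Fin B.numBlocks) (i i' j j' : Fin (B.dimA α)) :
    (fun β => B.blockUnit α i i' β * B.blockUnit α j j' β) =
      if i' = j then B.blockUnit α i j' else 0 := by
  funext β
  by_cases h : β = α
  · subst h
    by_cases h' : i' = j
    · subst h'
      simp [blockUnit]
    · simp [blockUnit, h', Matrix.single_mul_single_of_ne]
  · split_ifs <;> simp [blockUnit, Pi.single_eq_of_ne h]

theorem blockUnit_mul_blockUnit_of_ne {α α' : Fin B.numBlocks} (h : α ≠ α')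
    (i i' : Fin (B.dimA α)) (j j' : Fin (B.dimA α')) :
    (fun β => B.blockUnit α i i' β * B.blockUnit α' j j' β) = 0 := by
  funext β
  by_cases h' : β = α
  · subst h'
    simp [blockUnit, Pi.single_eq_of_ne h]
  · simp [blockUnit, Pi.single_eq_of_ne h']

theorem conjTranspose_blockUnit (α : Fin B.numBlocks) (i i' : Fin (B.dimA α)) :
    (fun β => (B.blockUnit α i i' β)ᴴ) = B.blockUnit α i' i := by
  funext β
  by_cases h' : β = α
  · subst h'
    simp [blockUnit, Matrix.conjTranspose_single]
  · simp [blockUnit, Pi.single_eq_of_ne h']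

theorem sum_smul_blockUnit (O : ∀ α, Matrix (Fin (B.dimA α)) (Fin (B.dimA α)) ℂ) :
    O = ∑ α, ∑ i, ∑ i', O α i i' • B.blockUnit α i i' := by
  funext β
  rw [Finset.sum_apply, Finset.sum_eq_single β]
  · conv_lhs => rw [Matrix.matrix_eq_sum_single (O β)]
    simp only [Finset.sum_apply, Pi.smul_apply, blockUnit, Pi.single_eq_same, Matrix.smul_single,
      smul_eq_mul, mul_one]
  · intro α _ h
    simp [blockUnit, Pi.single_eq_of_ne h.symm]
  · simp

theorem trace_blockOp_blockUnit (α : Fin B.numBlocks) (i : Fin (B.dimA α)) :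
    (B.blockOp (B.blockUnit α i i)).trace = B.dimAc α := by
  rw [blockOp_apply, Matrix.trace_mul_comm, ← Matrix.mul_assoc, B.isometry, Matrix.one_mul]
  simp only [Matrix.trace, Matrix.diag, Fintype.sum_sigma, Fintype.sum_prod_type,
    blockDiagonal'_apply_eq, kronecker_apply, Matrix.one_apply_eq, mul_one]
  rw [Finset.sum_eq_single α, Finset.sum_eq_single i]
  · simp [blockUnit]
  · intro j _ hj
    simp [blockUnit, Matrix.single_apply_of_row_ne hj.symm]
  · simp
  · intro β _ hβ
    simp [blockUnit, Pi.single_eq_of_ne hβ]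
  · simp

theorem exists_blockUnit_mul_mul (α : Fin B.numBlocks) (i : Fin (B.dimA α)) {X : Matrix κ κ ℂ}
    (hX : X ∈ M) : ∃ c : ℂ, B.blockOp (B.blockUnit α i i) * X * B.blockOp (B.blockUnit α i i) =
      c • B.blockOp (B.blockUnit α i i) := by
  obtain ⟨O, rfl⟩ := B.exists_eq_blockOp hX
  refine ⟨O α i i, ?_⟩
  rw [blockOp_mul, blockOp_mul, ← map_smul]
  congr 1
  funext β
  by_cases h : β = α
  · subst h
    simp [blockUnit, Matrix.smul_single]
  · simp [blockUnit, Pi.single_eq_of_ne h]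

variable {n : ℕ} {V : Matrix (Fin n → Fin 2) κ ℂ} {ψ : (Fin n → Fin 2) → ℂ}

/-- The operator `⨁ p_α ρ_{a_α} ⊗ 1 / dim a_α^c` has the same expectation values on the algebra as
the logical state of `ψ`: it is the conditional expectation of that state. -/
theorem trace_mul_eq_trace_blockOp_bulkBlock_mul {Z : Matrix κ κ ℂ} (hZ : Z ∈ M) :
    (Vᴴ * vecMulVec ψ (star ψ) * V * Z).trace =
      (B.blockOp (fun α => (B.dimAc α : ℂ)⁻¹ • B.bulkBlock V ψ α) * Z).trace := by
  obtain ⟨O, rfl⟩ := B.exists_eq_blockOp hZ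
  rw [trace_mul_blockOp, trace_mul_blockOp, conj_blockOp]
  refine Finset.sum_congr rfl fun α _ => Finset.sum_congr rfl fun i _ =>
    Finset.sum_congr rfl fun i' _ => ?_
  congr 1
  have h0 : (B.dimAc α : ℂ) ≠ 0 := Nat.cast_ne_zero.mpr (B.dimAc_pos α).ne'
  simp only [blockDiagonal'_apply_eq, kronecker_apply, Matrix.one_apply_eq, mul_one,
    Matrix.smul_apply, Finset.sum_const, Finset.card_univ, Fintype.card_fin, smul_eq_mul,
    nsmul_eq_mul]
  rw [mul_inv_cancel_left₀ h0]
  rfl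

theorem posSemidef_bulkState : (B.bulkState V ψ).PosSemidef := by
  -- `ψ` seen in each block as an operator from `a_α^c` to `a_α`
  let Y : Matrix (Σ α, Fin (B.dimA α)) (Σ α, Fin (B.dimAc α)) ℂ := blockDiagonal' fun α =>
    Matrix.of fun i j => (B.Wᴴ *ᵥ (Vᴴ *ᵥ ψ)) ⟨α, (i, j)⟩
  have h : B.bulkState V ψ = Y * Yᴴ := by
    rw [bulkState, blockDiagonal'_conjTranspose, ← blockDiagonal'_mul]
    congr 1
    funext α
    ext i i'
    have h1 : B.Wᴴ * (Vᴴ * vecMulVec ψ (star ψ) * V) * B.W =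
        vecMulVec (B.Wᴴ *ᵥ (Vᴴ *ᵥ ψ)) (star (B.Wᴴ *ᵥ (Vᴴ *ᵥ ψ))) := by
      rw [Matrix.mul_vecMulVec, Matrix.vecMulVec_mul, Matrix.mul_vecMulVec, Matrix.vecMulVec_mul,
        Matrix.star_mulVec, Matrix.star_mulVec, conjTranspose_conjTranspose,
        conjTranspose_conjTranspose]
    rw [bulkBlock, Matrix.of_apply, h1, Matrix.mul_apply]
    rfl
  rw [h]
  exact posSemidef_self_mul_conjTranspose Y

theorem trace_bulkState {S : Subgroup (QubitOp n)ˣ} (hV : IsEncoding S V) (hψ : ψ ∈ codeSpace S)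
    (hψ1 : IsUnitVector ψ) : (B.bulkState V ψ).trace = 1 := by
  have h1 : (B.bulkState V ψ).trace =
      (B.Wᴴ * (Vᴴ * vecMulVec ψ (star ψ) * V) * B.W).trace := by
    simp only [Matrix.trace, Matrix.diag, Fintype.sum_sigma, Fintype.sum_prod_type, bulkState,
      blockDiagonal'_apply_eq, bulkBlock, Matrix.of_apply]
  rw [h1, Matrix.trace_mul_comm, ← Matrix.mul_assoc, B.unitary, Matrix.one_mul,
    Matrix.trace_mul_comm, ← Matrix.mul_assoc, Matrix.mul_vecMulVec, hV.mul_mulVec hψ,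
    Matrix.trace_vecMulVec, dotProduct_comm]
  exact hψ1

end BlockDecomposition

/-! ### The reduced state in terms of the logical state -/

/-- The isometry `U` with `ρ_A = U (⨁ p_α ρ_{a_α} ⊗ 1/d) U†`. The rescaled reduction map
`θ` is multiplicative on the logical algebra, so it carries the matrix units of a block
decomposition to partial isometries between projections of rank `d`. -/
theorem exists_isometry_reducedState {n : ℕ} {S : Subgroup (QubitOp n)ˣ}
    (hS : IsStabilizerGroup S) {A : Finset (Fin n)}
    {K : Subgroup (localPauliGroup S A)} [Fintype K] (hKc : ∀ a ∈ K, ∀ b ∈ K, a * b = b * a)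
    (hK : ∀ g, (∀ k ∈ K, g * k = k * g) → g ∈ K) {d : ℕ} (hd0 : 0 < d)
    (hd : ∀ χ : K →* ℂˣ, charProj (localRep S A) K χ ≠ 0 →
      (charProj (localRep S A) K χ).trace = d)
    {κ : Type*} [Fintype κ] [DecidableEq κ] {V : Matrix (Fin n → Fin 2) κ ℂ}
    (hV : IsEncoding S V) (B : BlockDecomposition (logicalPauliAlgebra S A V)) :
    ∃ U : Matrix ({i // i ∈ A} → Fin 2) (Σ α : Fin B.numBlocks, Fin (B.dimA α) × Fin d) ℂ,
      Uᴴ * U = 1 ∧ ∀ ψ ∈ codeSpace S, reducedState A ψ =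
        U * blockDiagonal' (fun α => B.bulkBlock V ψ α ⊗ₖ
          ((d : ℂ)⁻¹ • (1 : Matrix (Fin d) (Fin d) ℂ))) * Uᴴ := by
  obtain ⟨lam, hlam0, hlamH, hlam⟩ := exists_reduceMap_one_mul_self (A := A) hV hS
  set θ : Matrix κ κ ℂ →ₗ[ℂ] Matrix ({i // i ∈ A} → Fin 2) ({i // i ∈ A} → Fin 2) ℂ :=
    lam⁻¹ • reduceMap A V with hθ
  have hθmul : ∀ O O', θ (B.blockOp O) * θ (B.blockOp O') =
      θ (B.blockOp fun α => O α * O' α) := by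
    intro O O'
    rw [hθ, LinearMap.smul_apply, LinearMap.smul_apply, LinearMap.smul_apply, Matrix.smul_mul,
      Matrix.mul_smul, reduceMap_mul hV hS hlam (B.blockOp_mem O) (B.blockOp_mem O'),
      B.blockOp_mul, inv_smul_smul₀ hlam0]
  have hθH : ∀ O, (θ (B.blockOp O))ᴴ = θ (B.blockOp fun α => (O α)ᴴ) := by
    intro O
    rw [hθ, LinearMap.smul_apply, LinearMap.smul_apply, conjTranspose_smul,
      conjTranspose_reduceMap, B.conjTranspose_blockOp, star_inv₀, hlamH]
  have hθ0 : θ (B.blockOp 0) = 0 := by rw [map_zero, map_zero]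
  -- an arbitrary reference basis vector in each block
  let o : ∀ α, Fin (B.dimA α) := fun α => ⟨0, B.dimA_pos α⟩
  have htr : ∀ α, (θ (B.blockOp (B.blockUnit α (o α) (o α)))).trace = d := by
    intro α
    refine trace_reduceMap_of_minimal hV hS hlam0 hlamH hlam hKc hK hd (B.blockOp_mem _) ?_ ?_ ?_
      fun X hX => B.exists_blockUnit_mul_mul α (o α) hX
    · rw [B.conjTranspose_blockOp, B.conjTranspose_blockUnit]
    · rw [B.blockOp_mul, B.blockUnit_mul_blockUnit, if_pos rfl]
    · rw [B.trace_blockOp_blockUnit]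
      exact Nat.cast_ne_zero.mpr (B.dimAc_pos α).ne'
  -- the reduction map preserves traces, so `d` also fixes the dimension of the second factors
  have hdim : ∀ α, (B.dimAc α : ℂ) = lam * d := by
    intro α
    rw [← htr α, hθ, LinearMap.smul_apply, trace_smul, trace_reduceMap hV,
      B.trace_blockOp_blockUnit, smul_eq_mul, mul_inv_cancel_left₀ hlam0]
  obtain ⟨U, hU, hUO, -⟩ := exists_isometry_of_partialIsometries (r := fun _ => d)
    (fun α => θ (B.blockOp (B.blockUnit α (o α) (o α))))
    (fun α => by rw [hθH, B.conjTranspose_blockUnit])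
    (fun α => by rw [hθmul, B.blockUnit_mul_blockUnit, if_pos rfl])
    htr (fun α i => θ (B.blockOp (B.blockUnit α i (o α))))
    (fun α i => by
      rw [hθH, B.conjTranspose_blockUnit, hθmul, B.blockUnit_mul_blockUnit, if_pos rfl])
    (fun α i i' h => by
      rw [hθH, B.conjTranspose_blockUnit, hθmul, B.blockUnit_mul_blockUnit, if_neg h, hθ0])
    (fun α β i i' h => by
      rw [hθH, B.conjTranspose_blockUnit, hθmul, B.blockUnit_mul_blockUnit_of_ne h, hθ0])
  have hUθ : ∀ O : ∀ α, Matrix (Fin (B.dimA α)) (Fin (B.dimA α)) ℂ,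
      U * blockDiagonal' (fun α => O α ⊗ₖ (1 : Matrix (Fin d) (Fin d) ℂ)) * Uᴴ =
        θ (B.blockOp O) := by
    intro O
    rw [hUO]
    conv_rhs => rw [B.sum_smul_blockUnit O]
    simp only [map_sum, map_smul]
    refine Finset.sum_congr rfl fun α _ => Finset.sum_congr rfl fun i _ =>
      Finset.sum_congr rfl fun i' _ => ?_
    rw [hθmul, B.blockUnit_mul_blockUnit, if_pos rfl, hθH, B.conjTranspose_blockUnit, hθmul,
      B.blockUnit_mul_blockUnit, if_pos rfl]
  refine ⟨U, hU, fun ψ hψ => ?_⟩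
  have h1 : (fun α => B.bulkBlock V ψ α ⊗ₖ ((d : ℂ)⁻¹ • (1 : Matrix (Fin d) (Fin d) ℂ))) =
      fun α => ((d : ℂ)⁻¹ • B.bulkBlock V ψ α) ⊗ₖ (1 : Matrix (Fin d) (Fin d) ℂ) := by
    funext α
    rw [kronecker_smul, smul_kronecker]
  have hd' : (d : ℂ) ≠ 0 := Nat.cast_ne_zero.mpr hd0.ne'
  have h2 : (fun α => (B.dimAc α : ℂ)⁻¹ • B.bulkBlock V ψ α) =
      lam⁻¹ • fun α => (d : ℂ)⁻¹ • B.bulkBlock V ψ α := by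
    funext α
    rw [Pi.smul_apply, smul_smul, hdim, mul_inv]
  rw [h1, hUθ, ← reduceMap_eq_reducedState hV hψ, reduceMap_eq_of_trace_eq hV hS
    (fun Z hZ => B.trace_mul_eq_trace_blockOp_bulkBlock_mul hZ), h2, map_smul, map_smul]
  rfl

theorem posSemidef_maximallyMixed (d : ℕ) :
    ((d : ℂ)⁻¹ • (1 : Matrix (Fin d) (Fin d) ℂ)).PosSemidef :=
  Matrix.PosSemidef.one.smul (inv_nonneg.mpr (Nat.cast_nonneg d))

theorem trace_maximallyMixed {d : ℕ} (hd : 0 < d) :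
    ((d : ℂ)⁻¹ • (1 : Matrix (Fin d) (Fin d) ℂ)).trace = 1 := by
  rw [trace_smul, trace_one, Fintype.card_fin, smul_eq_mul,
    inv_mul_cancel₀ (Nat.cast_ne_zero.mpr hd.ne')]

theorem mainTheorem1 {n : ℕ} (S : Subgroup (QubitOp n)ˣ) (hS : IsStabilizerGroup S)
    (A : Finset (Fin n)) :
    -- stabilizer reference states exist in the code subspace
    (∃ φ ∈ codeSpace S, IsStabilizerState φ) ∧
    -- the degeneracy `d` depends only on the code and on `A`
    ∃ d : ℕ, 0 < d ∧
      ∀ (κ : Type*) [Fintype κ] [DecidableEq κ] (V : Matrix (Fin n → Fin 2) κ ℂ),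
        IsEncoding S V →
        Nonempty (BlockDecomposition (logicalPauliAlgebra S A V)) ∧
        ∀ B : BlockDecomposition (logicalPauliAlgebra S A V),
          -- the area contribution `log d` is the (flat) entropy of the states `χ α` in
          -- `ρ_A = U (⨁_α p_α ρ_{a_α} ⊗ χ_α) U†`
          (∃ (c : Fin B.numBlocks → ℕ)
              (χ : ∀ α, Matrix (Fin (c α)) (Fin (c α)) ℂ)
              (U : Matrix ({i // i ∈ A} → Fin 2)
                (Σ α : Fin B.numBlocks, Fin (B.dimA α) × Fin (c α)) ℂ),
            (∀ α, (χ α).PosSemidef ∧ (χ α).trace = 1 ∧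
              ∀ t : ℝ≥0∞, renyiEntropy t (χ α) = Real.log d) ∧
            Uᴴ * U = 1 ∧
            ∀ ψ ∈ codeSpace S, IsUnitVector ψ →
              reducedState A ψ =
                U * Matrix.blockDiagonal' (fun α => B.bulkBlock V ψ α ⊗ₖ χ α) * Uᴴ) ∧
          ∀ ψ ∈ codeSpace S, IsUnitVector ψ →
            -- Rényi entropies of all orders
            (∀ t : ℝ≥0∞, renyiEntropy t (reducedState A ψ) =
              renyiEntropy t (B.bulkState V ψ) + Real.log d) ∧
            -- entanglement spectrum, with multiplicities
            (∃ z : ℕ, eigenvalueMultiset (reducedState A ψ) =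
              (eigenvalueMultiset (B.bulkState V ψ)).bind
                (fun μ => Multiset.replicate d (μ / (d : ℂ))) + Multiset.replicate z 0) ∧
            -- bulk entropy plus area term computed from a stabilizer reference state
            (∀ φ ∈ codeSpace S, IsStabilizerState φ →
              vonNeumannEntropy (reducedState A ψ) = vonNeumannEntropy (B.bulkState V ψ) +
                (vonNeumannEntropy (reducedState A φ) -
                  vonNeumannEntropy (B.bulkState V φ))) := by
  refine ⟨exists_isStabilizerState_mem hS, ?_⟩
  have := finite_localPauliGroup (S := S) (A := A)
  obtain ⟨K, hKc, hK⟩ := exists_maximal_commutative_subgroup (localPauliGroup S A)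
  have := Fintype.ofFinite K
  obtain ⟨d, hd0, hd⟩ := exists_trace_charProj_localRep (S := S) (A := A) hKc
  refine ⟨d, hd0, fun κ _ _ V hV => ⟨?_, fun B => ?_⟩⟩
  · refine nonempty_blockDecomposition_of_span (conjTranspose_logicalRep hV hS)
      (toSubmodule_logicalPauliAlgebra hV hS) hKc (z := ⟨-1, neg_one_mem_localPauliGroup⟩)
      (fun g => Subtype.ext ?_) mul_comm_or_of_mem_localPauliGroup hK (logicalRep_neg_one hV hS)
    simp
  obtain ⟨U, hU, hρ⟩ := exists_isometry_reducedState hS hKc hK hd0 hd hV B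
  have hspec := fun ψ (hψ : ψ ∈ codeSpace S) (hψ1 : IsUnitVector ψ) =>
    exists_spectrum_of_isometry_blockDiagonal (X := B.bulkBlock V ψ) (d := d)
      B.posSemidef_bulkState (B.trace_bulkState hV hψ hψ1) hU
  have hrenyi : ∀ ψ ∈ codeSpace S, IsUnitVector ψ → ∀ t : ℝ≥0∞,
      renyiEntropy t (reducedState A ψ) = renyiEntropy t (B.bulkState V ψ) + Real.log d := by
    intro ψ hψ hψ1 t
    obtain ⟨f, hf, hf1, hσ, z, hz⟩ := hspec ψ hψ hψ1
    rw [← hρ ψ hψ] at hz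
    exact renyiEntropy_eq_add_log hd0 f hf hf1 hσ hz t
  refine ⟨⟨fun _ => d, fun _ => (d : ℂ)⁻¹ • 1, U, fun _ => ⟨posSemidef_maximallyMixed d,
    trace_maximallyMixed hd0, renyiEntropy_maximallyMixed hd0⟩, hU, fun ψ hψ _ => hρ ψ hψ⟩,
    fun ψ hψ hψ1 => ⟨hrenyi ψ hψ hψ1, ?_, fun φ hφ hφ1 => ?_⟩⟩
  · obtain ⟨f, -, -, -, z, hz⟩ := hspec ψ hψ hψ1
    rw [← hρ ψ hψ] at hz
    exact ⟨z, hz⟩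
  · unfold vonNeumannEntropy
    rw [hrenyi ψ hψ hψ1, hrenyi φ hφ hφ1.1]
    ring
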